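/- A Lévy measure on $\mathbb{R}^d$ is a positive Borel measure $\nu$ with $\nu(\{0\})=0$ and $\int (1\wedge\|u\|_2^2)\,\nu(du)<\infty$. Write $X\sim ID(\gamma,0,\nu)$ if $$\mathbb{E}e^{i\langle t,X\rangle}=\exp\Big\{i\langle t,\gamma\rangle+\int_{\mathbb{R}^d}\big(e^{i\langle t,u\rangle}-1-i\langle t,u\rangle\mathbf{1}_{\|u\|_2\le 1}\big)\,\nu(du)\Big\},\qquad t\in\mathbb{R}^d .$$ Let $X=(X_1,\dots,X_d)\sim ID(\gamma,0,\nu)$ have independent components, and let $\mathbb{E}e^{s\|X\|_2}<+\infty$ for some $s>0$. For $k=1,\dots,d$ let $\tilde\nu_k$ be the one-dimensional Lévy measure of the $k$-th coordinate, $\tilde\nu_k(B)=\nu(\{x: x_k\in B,\ x_k\ne 0\})$; by independence, $\nu$ is carried by the coordinate axes and is the sum of the $\tilde\nu_k$, each placed on the $k$-th axis. Let $f:\mathbb{R}^d\to\mathbb{R}$ be such that $\mathbb{E}f(X)=0$, and let there exist $b_k\in\mathbb{R}$, $k=1,\dots,d$, such that $|f(x+ue_k)-f(x)|\le b_k|u|$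 for all $u\in\mathbb{R}$, $x\in\mathbb{R}^d$. Let $M=\sup\{s>0:\ \forall k=1,\dots,d,\ \mathbb{E}e^{s b_k|X_k|}<+\infty\}\in(0,+\infty]$. Then, for all $0\le t<M$, $$\mathbb{E}\big[f(X)e^{tf(X)}\big]\le\int_0^1\mathbb{E}_z\Big[\sum_{k=1}^d\int_{\mathbb{R}}\frac{|f(U+ue_k)-f(U)|^2+|f(V+ue_k)-f(V)|^2}{2}\,e^{tf(V)}\,\frac{e^{tb_k|u|}-1}{b_k|u|}\,\tilde\nu_k(du)\Big]dz,$$ all the integrals being finite (the inner integrand is read as $0$ when $b_k|u|=0$, where the increments of $f$ vanish). Here, for $0\le z\le1$, $\mathbb{E}_z$ is the expectation with respect to the infinitely divisible vector $(U,V)$ in $\mathbb{R}^{2d}$ without Gaussian part, with drift $(\gamma,\gamma)$ and Lévy measure $z\nu_1+(1-z)\nu_0$, where $\nu_0(du,dv)=\nu(du)\delta_0(dv)+\delta_0(du)\nu(dv)$ and $\nu_1$ is the image of $\nu$ under $u\mapsto(u,u)$. The truncation is applied to each $\mathbb{R}^d$-block separately, that is, for $s,r\in\mathbb{R}^d$,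 $$\mathbb{E}_z e^{i\langle s,U\rangle+i\langle r,V\rangle}=\exp\Big\{i\langle s+r,\gamma\rangle+\int\big(e^{i\langle s,u\rangle+i\langle r,v\rangle}-1-i\langle s,u\rangle\mathbf 1_{\|u\|_2\le1}-i\langle r,v\rangle\mathbf 1_{\|v\|_2\le1}\big)\,(z\nu_1+(1-z)\nu_0)(du,dv)\Big\},$$ so that $U$ and $V$ both have the law of $X$. -/

import Mathlib

open MeasureTheory ProbabilityTheory Set

noncomputable section

namespace IDVec

/-- Lévy measures: no atom at the origin, and `1 ∧ ‖u‖²` is integrable. -/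
structure IsLevyMeasure {E : Type*} [NormedAddCommGroup E] [MeasurableSpace E]
    (ν : Measure E) : Prop where
  zero_atom : ν {0} = 0
  lintegral_lt_top : ∫⁻ u, ENNReal.ofReal (min 1 (‖u‖ ^ 2)) ∂ν < ⊤

/-- The truncation function `u ↦ u 𝟏_{‖u‖ ≤ 1}`. -/
def trunc {E : Type*} [NormedAddCommGroup E] (u : E) : E :=
  open Classical in if ‖u‖ ≤ 1 then u else 0

/-- The truncation function `(u, v) ↦ (u 𝟏_{‖u‖ ≤ 1}, v 𝟏_{‖v‖ ≤ 1})` on pairs. -/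
def pairTrunc {E : Type*} [NormedAddCommGroup E] (p : WithLp 2 (E × E)) : WithLp 2 (E × E) :=
  WithLp.toLp 2 (trunc p.fst, trunc p.snd)

/-- The probability law `μ` is infinitely divisible without Gaussian part, with Lévy measure `ν`
and with drift parameter `γ` relative to the truncation function `h`: its characteristic function is
`t ↦ exp (i⟨t, γ⟩ + ∫ (e^{i⟨t, u⟩} - 1 - i⟨t, h u⟩) ν(du))`. -/
structure IsIDLaw {E : Type*} [NormedAddCommGroup E] [InnerProductSpace ℝ E] [MeasurableSpace E]
    (h : E → E) (γ : E) (ν : Measure E) (μ : Measure E) : Prop where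
  isProbabilityMeasure : IsProbabilityMeasure μ
  isLevyMeasure : IsLevyMeasure ν
  charFun_eq : ∀ t : E, charFun μ t =
    Complex.exp (((inner ℝ t γ : ℝ) : ℂ) * Complex.I +
      ∫ u, (Complex.exp (((inner ℝ t u : ℝ) : ℂ) * Complex.I) - 1
        - ((inner ℝ t (h u) : ℝ) : ℂ) * Complex.I) ∂ν)

/-- The measure `ν(du) δ₀(dv) + δ₀(du) ν(dv)` on pairs. -/
def levyIndep {E : Type*} [NormedAddCommGroup E] [MeasurableSpace E] (ν : Measure E) :
    Measure (WithLp 2 (E × E)) :=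
  ν.map (fun u => WithLp.toLp 2 (u, (0 : E))) + ν.map (fun v => WithLp.toLp 2 ((0 : E), v))

/-- The measure `ν` carried by the main diagonal of the space of pairs. -/
def levyDiag {E : Type*} [NormedAddCommGroup E] [MeasurableSpace E] (ν : Measure E) :
    Measure (WithLp 2 (E × E)) :=
  ν.map (fun u => WithLp.toLp 2 (u, u))

/-- The interpolating Lévy measure `z ν₁ + (1 - z) ν₀`, for `0 ≤ z ≤ 1`. -/
def levyInterp {E : Type*} [NormedAddCommGroup E] [MeasurableSpace E] (ν : Measure E) (z : ℝ) :
    Measure (WithLp 2 (E × E)) :=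
  ENNReal.ofReal z • levyDiag ν + ENNReal.ofReal (1 - z) • levyIndep ν

/-- The one-dimensional Lévy measure of the `k`-th coordinate:
`B ↦ ν {x | x k ∈ B, x k ≠ 0}`. When `ν` is carried by the axes, `ν` is the sum over `k` of these
measures, the `k`-th one placed on the `k`-th axis. -/
def coordLevy {d : ℕ} (ν : Measure (EuclideanSpace ℝ (Fin d))) (k : Fin d) : Measure ℝ :=
  (ν.map (fun x => x k)).restrict {0}ᶜ

/-- The `k`-th unit vector of `ℝᵈ`. -/
def unitVec {d : ℕ} (k : Fin d) : EuclideanSpace ℝ (Fin d) := EuclideanSpace.single k (1 : ℝ)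

/-- `(|f(x + u eₖ) - f(x)|² + |f(y + u eₖ) - f(y)|²) / 2 · e^{t f(y)} (e^{t bₖ |u|} - 1)/(bₖ |u|)`.
If `bₖ |u| = 0`, the increments vanish for the functions considered, so that the value
of the last quotient does not matter. -/
def integrand {d : ℕ} (f : EuclideanSpace ℝ (Fin d) → ℝ) (b : Fin d → ℝ) (t : ℝ) (k : Fin d)
    (x y : EuclideanSpace ℝ (Fin d)) (u : ℝ) : ℝ :=
  (|f (x + u • unitVec k) - f x| ^ 2 + |f (y + u • unitVec k) - f y| ^ 2) / 2
    * Real.exp (t * f y) * ((Real.exp (t * b k * |u|) - 1) / (b k * |u|))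

/-- `M = sup {s > 0 : ∀ k, E e^{s bₖ |Xₖ|} < ∞}`, possibly `+∞`. -/
def expRadius {Ω : Type*} [MeasurableSpace Ω] (P : Measure Ω) {d : ℕ}
    (X : Ω → EuclideanSpace ℝ (Fin d)) (b : Fin d → ℝ) : EReal :=
  sSup ((fun s : ℝ => (s : EReal)) ''
    {s : ℝ | 0 < s ∧ ∀ k, Integrable (fun ω => Real.exp (s * b k * |X ω k|)) P})

end IDVec

end

/-! The proof rests on a covariance representation: for bounded Lipschitz f and g, Cov(f(X), g(X)) =
∫₀¹ E_z ∫ (f(U+u) - f(U)) (g(V+u) - g(V)) ν(du) dz. For characters with frequencies s and r, the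
characteristic function of (U, V) is exp(a(s) + a(r) + zK), where a is the exponent of X and K = ∫
(e^{i⟨s,u⟩} - 1)(e^{i⟨r,u⟩} - 1) ν(du) is the defect a(s+r) - a(s) - a(r). The jump integral
multiplies by K, so the integrand is a z-derivative and integrates to φ(s+r) - φ(s)φ(r), with φ =
e^a (`integral_jump_chi`). Fourier inversion extends this to Schwartz functions, cutoff and
mollification to bounded Lipschitz ones (`integral_jump_lipschitz`).

Independence forces ν onto the axes (`ae_mul_coord_eq_zero`), so each jump moves a single
coordinate. The identity is applied to a truncation of f and to the exponential of t times that
truncation. By convexity |e^{tδ} - 1| ≤ |δ| (e^{tβ} - 1)/β for |δ| ≤ β, and |a||c| ≤ (a² + c²)/2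
turns the product of increments into the stated energy (`abs_clamp_cross_le`).

The energy is bounded uniformly in (U, V) once y(e^{ty} - 1), with y = b_k|u|, is integrable against
each coordinate Lévy measure. This follows from the same covariance identity, applied to truncations
of a linear form and of its exponential, and from Fatou's lemma (`integrable_mul_exp_sub_one`). The
truncation of f is removed by dominated convergence, and E f(X) = 0 eliminates the product of means
(`energy_inequality`). -/

set_option linter.unusedSectionVars false

noncomputable section

namespace IDVec

open Filter Topology

/-! ### Characters, the Lévy exponent and its additivity defect. -/

section LevyExponent

variable {E : Type*} [NormedAddCommGroup E] [InnerProductSpace ℝ E]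

/-- The character `u ↦ e^{i⟨s, u⟩}`. -/
def chi (s u : E) : ℂ := Complex.exp (((inner ℝ s u : ℝ) : ℂ) * Complex.I)

lemma chi_add_left (s r u : E) : chi (s + r) u = chi s u * chi r u := by
  simp only [chi, inner_add_left, Complex.ofReal_add, add_mul, Complex.exp_add]

lemma chi_add_right (s u v : E) : chi s (u + v) = chi s u * chi s v := by
  simp only [chi, inner_add_right, Complex.ofReal_add, add_mul, Complex.exp_add]

@[simp] lemma norm_chi (s u : E) : ‖chi s u‖ = 1 := by
  simp [chi, Complex.norm_exp]

@[simp] lemma chi_zero_right (s : E) : chi s 0 = 1 := by simp [chi]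

@[simp] lemma chi_zero_left (u : E) : chi 0 u = 1 := by simp [chi]

lemma continuous_chi : Continuous fun p : E × E => chi p.1 p.2 := by
  unfold chi; fun_prop

@[fun_prop]
lemma continuous_chi_comp {Y : Type*} [TopologicalSpace Y] {a b : Y → E} (ha : Continuous a)
    (hb : Continuous b) : Continuous fun y => chi (a y) (b y) :=
  continuous_chi.comp (ha.prodMk hb)

lemma norm_exp_mul_I_sub_one_le (x : ℝ) : ‖Complex.exp ((x : ℂ) * Complex.I) - 1‖ ≤ |x| := by
  rw [mul_comm]
  simpa using! Real.norm_exp_I_mul_ofReal_sub_one_le (x := x)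

lemma norm_exp_mul_I_sub_one_sub_le (x : ℝ) :
    ‖Complex.exp ((x : ℂ) * Complex.I) - 1 - (x : ℂ) * Complex.I‖ ≤ 3 * x ^ 2 := by
  rcases le_or_gt |x| 1 with hx | hx
  · have := Complex.norm_exp_sub_one_sub_id_le (x := (x : ℂ) * Complex.I) (by simpa using hx)
    refine this.trans ?_
    simp only [norm_mul, Complex.norm_real, Complex.norm_I, mul_one, Real.norm_eq_abs, sq_abs]
    nlinarith [sq_nonneg x]
  · have h1 := norm_exp_mul_I_sub_one_le x
    have h2 : ‖(x : ℂ) * Complex.I‖ = |x| := by simp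
    refine (norm_sub_le _ _).trans ?_
    rw [h2]
    nlinarith [sq_abs x]

lemma norm_chi_sub_one_le_two (s u : E) : ‖chi s u - 1‖ ≤ 2 := by
  refine (norm_sub_le _ _).trans ?_
  simp; norm_num

lemma norm_chi_sub_one_le_mul (s u : E) : ‖chi s u - 1‖ ≤ ‖s‖ * ‖u‖ :=
  (norm_exp_mul_I_sub_one_le _).trans (abs_real_inner_le_norm s u)

lemma norm_chi_sub_one_le (s u : E) : ‖chi s u - 1‖ ≤ (2 + ‖s‖) * min 1 ‖u‖ := by
  rcases le_total 1 ‖u‖ with h | h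
  · rw [min_eq_left h]
    linarith [norm_chi_sub_one_le_two s u, norm_nonneg s]
  · rw [min_eq_right h]
    nlinarith [norm_chi_sub_one_le_mul s u, norm_nonneg s, norm_nonneg u]

lemma min_one_norm_sq (u : E) : (min 1 ‖u‖) ^ 2 = min 1 (‖u‖ ^ 2) := by
  rcases le_total 1 ‖u‖ with h | h
  · rw [min_eq_left h, min_eq_left (by nlinarith)]; norm_num
  · rw [min_eq_right h, min_eq_right (by nlinarith [norm_nonneg u])]

/-- The integrand of the Lévy exponent. -/
def levyKer (s u : E) : ℂ := chi s u - 1 - ((inner ℝ s (trunc u) : ℝ) : ℂ) * Complex.I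

/-- The compensator cancels the linear term for small jumps and is absent for large ones. The bound
has the form that a Lévy measure integrates. -/
lemma norm_levyKer_le (s u : E) :
    ‖levyKer s u‖ ≤ (2 + 3 * ‖s‖ ^ 2) * (min 1 ‖u‖) ^ 2 := by
  unfold levyKer trunc
  split_ifs with h
  · rw [min_eq_right h]
    have h1 := norm_exp_mul_I_sub_one_sub_le (inner ℝ s u)
    have h2 := abs_real_inner_le_norm s u
    have h3 : (inner ℝ s u) ^ 2 ≤ (‖s‖ * ‖u‖) ^ 2 := sq_le_sq' (by linarith [abs_le.1 h2]) (abs_le.1 h2).2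
    unfold chi
    nlinarith [sq_nonneg ‖u‖]
  · rw [min_eq_left (not_le.1 h).le]
    simp only [inner_zero_right, Complex.ofReal_zero, zero_mul, sub_zero]
    nlinarith [norm_chi_sub_one_le_two s u, sq_nonneg ‖s‖]

/-- The compensator is linear in the frequency, so the whole defect comes from the multiplicativity
of the character. -/
lemma levyKer_add_left (s r u : E) :
    levyKer (s + r) u = levyKer s u + levyKer r u + (chi s u - 1) * (chi r u - 1) := by
  simp only [levyKer, chi_add_left, inner_add_left, Complex.ofReal_add]
  ring

variable [MeasurableSpace E] [BorelSpace E]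

lemma measurable_trunc : Measurable (trunc : E → E) := by
  classical
  have : (trunc : E → E) = fun u => if u ∈ {u : E | ‖u‖ ≤ 1} then u else 0 := by
    funext u; simp [trunc]
  rw [this]
  exact Measurable.ite (measurableSet_le measurable_norm measurable_const) measurable_id
    measurable_const

lemma IsLevyMeasure.integrable_min_sq {ν : Measure E} (hν : IsLevyMeasure ν) :
    Integrable (fun u => (min 1 ‖u‖) ^ 2) ν := by
  simp_rw [min_one_norm_sq]
  refine ⟨(by fun_prop : Measurable fun u : E => min 1 (‖u‖ ^ 2)).aestronglyMeasurable, ?_⟩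
  rw [hasFiniteIntegral_iff_ofReal (ae_of_all _ fun u => by positivity)]
  exact hν.lintegral_lt_top

/-- The weight `min 1 ‖u‖²` is positive off the null set {0}, so ν is recovered from a finite
measure by the inverse density. Fubini's theorem for products with ν relies on this. -/
lemma IsLevyMeasure.sFinite {ν : Measure E} (hν : IsLevyMeasure ν) : SFinite ν := by
  have hm : Measurable fun u : E => ENNReal.ofReal (min 1 (‖u‖ ^ 2)) := by fun_prop
  have h0 : ∀ᵐ u ∂ν, u ≠ 0 := by
    rw [ae_iff]; simpa using hν.zero_atom
  rw [← withDensity_inv_same₀ (μ := ν) hm.aemeasurable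
    (by
      filter_upwards [h0] with u hu
      have : 0 < ‖u‖ := norm_pos_iff.2 hu
      have : 0 < min 1 (‖u‖ ^ 2) := by positivity
      exact (ENNReal.ofReal_pos.2 this).ne')
    (ae_of_all _ fun u => ENNReal.ofReal_ne_top)]
  have := isFiniteMeasure_withDensity hν.lintegral_lt_top.ne
  infer_instance

variable [SecondCountableTopology E] {ν : Measure E}

lemma IsLevyMeasure.integrable_of_norm_le {F : Type*} [NormedAddCommGroup F]
    (hν : IsLevyMeasure ν) {h : E → F} (hm : AEStronglyMeasurable h ν) (C : ℝ)
    (hC : ∀ u, ‖h u‖ ≤ C * (min 1 ‖u‖) ^ 2) : Integrable h ν :=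
  (hν.integrable_min_sq.const_mul C).mono' hm (ae_of_all _ hC)

lemma measurable_levyKer (s : E) : Measurable (levyKer s) := by
  have := measurable_trunc (E := E)
  have h : Measurable (chi s) := (by fun_prop : Continuous fun u => chi s u).measurable
  unfold levyKer
  fun_prop

lemma IsLevyMeasure.integrable_levyKer (hν : IsLevyMeasure ν) (s : E) :
    Integrable (levyKer s) ν :=
  hν.integrable_of_norm_le (measurable_levyKer s).aestronglyMeasurable _ (norm_levyKer_le s)

lemma norm_chi_cross_le (s r u : E) :
    ‖(chi s u - 1) * (chi r u - 1)‖ ≤ ((2 + ‖s‖) * (2 + ‖r‖)) * (min 1 ‖u‖) ^ 2 := by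
  rw [norm_mul]
  calc _ ≤ ((2 + ‖s‖) * min 1 ‖u‖) * ((2 + ‖r‖) * min 1 ‖u‖) :=
        mul_le_mul (norm_chi_sub_one_le s u) (norm_chi_sub_one_le r u) (norm_nonneg _)
          (by positivity)
    _ = _ := by ring

lemma IsLevyMeasure.integrable_chi_cross (hν : IsLevyMeasure ν) (s r : E) :
    Integrable (fun u => (chi s u - 1) * (chi r u - 1)) ν :=
  hν.integrable_of_norm_le
    (by fun_prop : Continuous fun u => (chi s u - 1) * (chi r u - 1)).aestronglyMeasurable _
    (norm_chi_cross_le s r)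

/-- The Lévy exponent, without drift. -/
def levyExp (ν : Measure E) (s : E) : ℂ := ∫ u, levyKer s u ∂ν

/-- The bilinear defect of the Lévy exponent. -/
def levyCross (ν : Measure E) (s r : E) : ℂ := ∫ u, (chi s u - 1) * (chi r u - 1) ∂ν

lemma IsLevyMeasure.levyExp_add (hν : IsLevyMeasure ν) (s r : E) :
    levyExp ν (s + r) = levyExp ν s + levyExp ν r + levyCross ν s r := by
  unfold levyExp levyCross
  simp_rw [levyKer_add_left]
  rw [integral_add (f := fun u => levyKer s u + levyKer r u)
    ((hν.integrable_levyKer s).add (hν.integrable_levyKer r))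
    (hν.integrable_chi_cross s r), integral_add (hν.integrable_levyKer s) (hν.integrable_levyKer r)]

lemma charFun_eq_integral_chi (μ : Measure E) (s : E) : charFun μ s = ∫ x, chi s x ∂μ := by
  simp_rw [charFun_apply, chi, real_inner_comm]

lemma IsIDLaw.charFun_eq_exp {γ : E} {μ : Measure E} (h : IsIDLaw trunc γ ν μ) (s : E) :
    charFun μ s = Complex.exp (((inner ℝ s γ : ℝ) : ℂ) * Complex.I + levyExp ν s) := by
  rw [h.charFun_eq s]; rfl

/-- The Lévy exponent of the interpolating Lévy measure. -/
lemma integral_levyKer_levyInterp (hν : IsLevyMeasure ν) {z : ℝ} (hz : z ∈ Icc (0 : ℝ) 1)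
    (s r : E) :
    ∫ p, (Complex.exp (((inner ℝ (WithLp.toLp 2 (s, r)) p : ℝ) : ℂ) * Complex.I) - 1
        - ((inner ℝ (WithLp.toLp 2 (s, r)) (pairTrunc p) : ℝ) : ℂ) * Complex.I)
        ∂(levyInterp ν z) =
      levyExp ν s + levyExp ν r + z * levyCross ν s r := by
  set k : WithLp 2 (E × E) → ℂ := fun p =>
    (Complex.exp (((inner ℝ (WithLp.toLp 2 (s, r)) p : ℝ) : ℂ) * Complex.I) - 1
        - ((inner ℝ (WithLp.toLp 2 (s, r)) (pairTrunc p) : ℝ) : ℂ) * Complex.I) with hk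
  have hkm : Measurable k := by
    have := measurable_trunc (E := E)
    simp only [hk, pairTrunc, WithLp.prod_inner_apply]
    fun_prop
  have t0 : trunc (0 : E) = 0 := by simp [trunc]
  -- Blockwise truncation makes the diagonal part produce the exponent at s + r, while each half of
  -- the independent part sees one frequency only. The convex combination then leaves z times the
  -- defect.
  have k1 : ∀ u, k (WithLp.toLp 2 (u, u)) = levyKer (s + r) u := fun u => by
    simp [hk, levyKer, chi, pairTrunc, inner_add_left]
  have k2 : ∀ u, k (WithLp.toLp 2 (u, 0)) = levyKer s u := fun u => by
    simp [hk, levyKer, chi, pairTrunc, t0]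
  have k3 : ∀ u, k (WithLp.toLp 2 (0, u)) = levyKer r u := fun u => by
    simp [hk, levyKer, chi, pairTrunc, t0]
  have m1 : Measurable fun u : E => WithLp.toLp 2 (u, u) := by fun_prop
  have m2 : Measurable fun u : E => WithLp.toLp 2 (u, (0 : E)) := by fun_prop
  have m3 : Measurable fun u : E => WithLp.toLp 2 ((0 : E), u) := by fun_prop
  have i1 : Integrable k (levyDiag ν) := by
    rw [levyDiag, integrable_map_measure hkm.aestronglyMeasurable m1.aemeasurable]
    simpa only [Function.comp_def, k1] using hν.integrable_levyKer (s + r)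
  have i2 : Integrable k (ν.map fun u => WithLp.toLp 2 (u, (0 : E))) := by
    rw [integrable_map_measure hkm.aestronglyMeasurable m2.aemeasurable]
    simpa only [Function.comp_def, k2] using hν.integrable_levyKer s
  have i3 : Integrable k (ν.map fun u => WithLp.toLp 2 ((0 : E), u)) := by
    rw [integrable_map_measure hkm.aestronglyMeasurable m3.aemeasurable]
    simpa only [Function.comp_def, k3] using hν.integrable_levyKer r
  have j1 : ∫ p, k p ∂(levyDiag ν) = levyExp ν (s + r) := by
    rw [levyDiag, integral_map m1.aemeasurable hkm.aestronglyMeasurable]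
    simp only [k1, levyExp]
  have j2 : ∫ p, k p ∂(levyIndep ν) = levyExp ν s + levyExp ν r := by
    rw [levyIndep, integral_add_measure i2 i3,
      integral_map m2.aemeasurable hkm.aestronglyMeasurable,
      integral_map m3.aemeasurable hkm.aestronglyMeasurable]
    simp only [k2, k3, levyExp]
  have i4 : Integrable k (levyIndep ν) := i2.add_measure i3
  rw [levyInterp, integral_add_measure (i1.smul_measure ENNReal.ofReal_ne_top)
    (i4.smul_measure ENNReal.ofReal_ne_top), integral_smul_measure,
    integral_smul_measure, j1, j2, ENNReal.toReal_ofReal hz.1, ENNReal.toReal_ofReal (by linarith [hz.2]),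
    hν.levyExp_add]
  simp only [Complex.real_smul, Complex.ofReal_sub, Complex.ofReal_one]
  ring

/-- The parameter z enters the exponent only through the linear term zK, which makes the
z-derivative explicit. -/
lemma IsIDLaw.charFun_interp (hν : IsLevyMeasure ν) {z : ℝ} (hz : z ∈ Icc (0 : ℝ) 1)
    {γ : E} {μ : Measure (WithLp 2 (E × E))}
    (h : IsIDLaw pairTrunc (WithLp.toLp 2 (γ, γ)) (levyInterp ν z) μ) (s r : E) :
    charFun μ (WithLp.toLp 2 (s, r)) =
      Complex.exp (((inner ℝ s γ : ℝ) : ℂ) * Complex.I + levyExp ν s +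
        (((inner ℝ r γ : ℝ) : ℂ) * Complex.I + levyExp ν r) + z * levyCross ν s r) := by
  rw [h.charFun_eq, integral_levyKer_levyInterp hν hz]
  congr 1
  simp only [WithLp.prod_inner_apply, Complex.ofReal_add]
  ring

end LevyExponent

/-! ### The interpolating laws, and the covariance identity for characters. -/

section Interpolation

variable {E : Type*} [NormedAddCommGroup E] [InnerProductSpace ℝ E] [FiniteDimensional ℝ E]
  [MeasurableSpace E] [BorelSpace E]

/-- `μ` is the infinitely divisible law with drift `γ` and Lévy measure `ν`, and `ρ` is the
interpolating family between two independent copies and two equal copies of `μ`. -/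
structure IsInterpolation (γ : E) (ν μ : Measure E) (ρ : ℝ → Measure (WithLp 2 (E × E))) :
    Prop where
  isIDLaw : IsIDLaw trunc γ ν μ
  isIDLaw_pair : ∀ z ∈ Icc (0 : ℝ) 1,
    IsIDLaw pairTrunc (WithLp.toLp 2 (γ, γ)) (levyInterp ν z) (ρ z)

variable {γ : E} {ν μ : Measure E} {ρ : ℝ → Measure (WithLp 2 (E × E))}

namespace IsInterpolation

lemma isLevyMeasure (h : IsInterpolation γ ν μ ρ) : IsLevyMeasure ν := h.isIDLaw.isLevyMeasure

lemma charFun_pair (h : IsInterpolation γ ν μ ρ) {z : ℝ} (hz : z ∈ Icc (0 : ℝ) 1) (s r : E) :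
    charFun (ρ z) (WithLp.toLp 2 (s, r)) =
      Complex.exp (((inner ℝ s γ : ℝ) : ℂ) * Complex.I + levyExp ν s +
        (((inner ℝ r γ : ℝ) : ℂ) * Complex.I + levyExp ν r) + z * levyCross ν s r) :=
  (h.isIDLaw_pair z hz).charFun_interp h.isLevyMeasure hz s r

lemma map_snd (h : IsInterpolation γ ν μ ρ) {z : ℝ} (hz : z ∈ Icc (0 : ℝ) 1) :
    (ρ z).map (fun p => p.snd) = μ := by
  have := (h.isIDLaw_pair z hz).isProbabilityMeasure
  have := h.isIDLaw.isProbabilityMeasure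
  have hm : Measurable fun p : WithLp 2 (E × E) => p.snd := by fun_prop
  have := Measure.isProbabilityMeasure_map (μ := ρ z) hm.aemeasurable
  refine Measure.ext_of_charFun (funext fun r => ?_)
  have e1 : charFun ((ρ z).map fun p => p.snd) r = charFun (ρ z) (WithLp.toLp 2 (0, r)) := by
    rw [charFun_eq_integral_chi, charFun_eq_integral_chi, integral_map hm.aemeasurable
      (by fun_prop : Continuous fun x => chi r x).aestronglyMeasurable]
    simp [chi]
  rw [e1, h.charFun_pair hz, h.isIDLaw.charFun_eq_exp]
  simp [levyExp, levyKer, levyCross]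

/-- Characteristic functions are continuous in z, so Lévy's continuity theorem gives weak
continuity. The projection onto [0, 1] is there because ρ is prescribed only on that interval. -/
lemma continuous_lintegral_boundedContinuous (h : IsInterpolation γ ν μ ρ)
    (F : BoundedContinuousFunction (WithLp 2 (E × E)) NNReal) :
    Continuous fun z : ℝ => ∫⁻ p, F p ∂(ρ (projIcc (0 : ℝ) 1 zero_le_one z)) := by
  let m : ℝ → ProbabilityMeasure (WithLp 2 (E × E)) := fun z =>
    ⟨ρ (projIcc (0 : ℝ) 1 zero_le_one z),
      (h.isIDLaw_pair _ (projIcc (0 : ℝ) 1 zero_le_one z).2).isProbabilityMeasure⟩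
  have hm : Continuous m := by
    refine continuous_iff_seqContinuous.2 fun x a hx => ?_
    refine ProbabilityMeasure.tendsto_of_tendsto_charFun fun t => ?_
    have key : Continuous fun z : ℝ => charFun (m z : Measure (WithLp 2 (E × E))) t := by
      have : ∀ z, charFun (m z : Measure (WithLp 2 (E × E))) t = _ := fun z =>
        h.charFun_pair (projIcc (0 : ℝ) 1 zero_le_one z).2 t.fst t.snd
      rw [funext this]
      have h2 : Continuous fun z : ℝ => ((projIcc (0 : ℝ) 1 zero_le_one z : Icc (0 : ℝ) 1) : ℝ) :=
        continuous_subtype_val.comp continuous_projIcc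
      fun_prop
    exact (key.tendsto a).comp hx
  exact continuous_iff_continuousAt.2 fun z =>
    ProbabilityMeasure.tendsto_iff_forall_lintegral_tendsto.1 hm.continuousAt F

/-- Measurability in z is derived from weak continuity: closed sets form a generating π-system, and
their indicators are limits of thickened, continuous ones. -/
lemma measurable_family (h : IsInterpolation γ ν μ ρ) :
    Measurable fun z : ℝ => ρ (projIcc (0 : ℝ) 1 zero_le_one z) := by
  have hp : ∀ z : ℝ, IsProbabilityMeasure (ρ (projIcc (0 : ℝ) 1 zero_le_one z)) := fun z =>
    (h.isIDLaw_pair _ (projIcc (0 : ℝ) 1 zero_le_one z).2).isProbabilityMeasure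
  refine Measurable.measure_of_isPiSystem_of_isProbabilityMeasure
    ((BorelSpace.measurable_eq).trans (borel_eq_generateFrom_isClosed)) isPiSystem_isClosed
    fun F hF => ?_
  have hF : IsClosed F := hF
  obtain ⟨δ, -, δpos, δlim⟩ := exists_seq_strictAnti_tendsto (0 : ℝ)
  refine measurable_of_tendsto_metrizable
    (f := fun n z => ∫⁻ p, (thickenedIndicator (δpos n) F p : ENNReal)
      ∂(ρ (projIcc (0 : ℝ) 1 zero_le_one z)))
    (fun n => (h.continuous_lintegral_boundedContinuous _).measurable) ?_
  exact tendsto_pi_nhds.2 fun z => tendsto_lintegral_thickenedIndicator_of_isClosed _ hF δpos δlim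

/-- The interpolating family as a Markov kernel, extended to be constant outside `[0, 1]`. -/
def kernel (h : IsInterpolation γ ν μ ρ) : Kernel ℝ (WithLp 2 (E × E)) where
  toFun z := ρ (projIcc (0 : ℝ) 1 zero_le_one z)
  measurable' := h.measurable_family

lemma kernel_apply (h : IsInterpolation γ ν μ ρ) {z : ℝ} (hz : z ∈ Icc (0 : ℝ) 1) :
    h.kernel z = ρ z := by
  change ρ (projIcc (0 : ℝ) 1 zero_le_one z) = ρ z
  rw [projIcc_of_mem _ hz]

instance (h : IsInterpolation γ ν μ ρ) : IsMarkovKernel h.kernel :=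
  ⟨fun z => (h.isIDLaw_pair _ (projIcc (0 : ℝ) 1 zero_le_one z).2).isProbabilityMeasure⟩

/-- The mixture over `z ∈ (0, 1]` of the interpolating laws. -/
def mixture (h : IsInterpolation γ ν μ ρ) : Measure (ℝ × WithLp 2 (E × E)) :=
  (volume.restrict (Ioc (0 : ℝ) 1)) ⊗ₘ h.kernel

instance (h : IsInterpolation γ ν μ ρ) : IsProbabilityMeasure h.mixture := by
  have : IsProbabilityMeasure ((volume : Measure ℝ).restrict (Ioc (0 : ℝ) 1)) := ⟨by simp⟩
  unfold mixture; infer_instance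

lemma integral_mixture (h : IsInterpolation γ ν μ ρ) {F : Type*} [NormedAddCommGroup F]
    [NormedSpace ℝ F] {k : ℝ × WithLp 2 (E × E) → F} (hk : Integrable k h.mixture) :
    ∫ y, k y ∂h.mixture = ∫ z in (0 : ℝ)..1, ∫ p, k (z, p) ∂(ρ z) := by
  rw [mixture, Measure.integral_compProd hk, intervalIntegral.integral_of_le zero_le_one]
  refine setIntegral_congr_fun measurableSet_Ioc fun z hz => ?_
  simp only [h.kernel_apply (Ioc_subset_Icc_self hz)]

/-- Reduces the integrability of functions of V under the mixture to integrability under μ. -/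
lemma map_snd_mixture (h : IsInterpolation γ ν μ ρ) :
    h.mixture.map (fun y => y.2.snd) = μ := by
  ext s hs
  have hm : Measurable fun y : ℝ × WithLp 2 (E × E) => y.2.snd := by fun_prop
  have hm2 : Measurable fun y : WithLp 2 (E × E) => y.snd := by fun_prop
  rw [Measure.map_apply hm hs, mixture, Measure.compProd_apply (hm hs)]
  have : ∀ z ∈ Ioc (0 : ℝ) 1, h.kernel z (Prod.mk z ⁻¹' ((fun y => y.2.snd) ⁻¹' s)) = μ s := by
    intro z hz
    rw [h.kernel_apply (Ioc_subset_Icc_self hz), ← h.map_snd (Ioc_subset_Icc_self hz),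
      Measure.map_apply hm2 hs]
    rfl
  rw [setLIntegral_congr_fun measurableSet_Ioc this]
  simp

/-- The measure `dz ρ_z(dp) ν(du)`. -/
def jump (h : IsInterpolation γ ν μ ρ) : Measure ((ℝ × WithLp 2 (E × E)) × E) :=
  h.mixture.prod ν

lemma integral_chi_mixture (h : IsInterpolation γ ν μ ρ) (s r : E) :
    ∫ y, chi s y.2.fst * chi r y.2.snd ∂h.mixture =
      ∫ z in (0 : ℝ)..1, Complex.exp (((inner ℝ s γ : ℝ) : ℂ) * Complex.I + levyExp ν s +
        (((inner ℝ r γ : ℝ) : ℂ) * Complex.I + levyExp ν r) + z * levyCross ν s r) := by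
  rw [h.integral_mixture]
  · refine intervalIntegral.integral_congr fun z hz => ?_
    rw [uIcc_of_le zero_le_one] at hz
    simp only []
    rw [← h.charFun_pair hz, charFun_eq_integral_chi]
    refine integral_congr_ae (ae_of_all _ fun p => ?_)
    simp [chi, ← Complex.exp_add, add_mul]
  · refine Integrable.of_bound (C := 1)
      (by fun_prop : Continuous fun y : ℝ × WithLp 2 (E × E) =>
        chi s y.2.fst * chi r y.2.snd).aestronglyMeasurable (ae_of_all _ fun y => ?_)
    simp

/-- The covariance identity for characters. -/
lemma integral_jump_chi (h : IsInterpolation γ ν μ ρ) (s r : E) :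
    ∫ q, (chi s (q.1.2.fst + q.2) - chi s q.1.2.fst) * (chi r (q.1.2.snd + q.2) - chi r q.1.2.snd)
        ∂h.jump = charFun μ (s + r) - charFun μ s * charFun μ r := by
  have := h.isLevyMeasure.sFinite
  -- Increments of characters factor, so the integral over u separates from (z, U, V) and
  -- contributes exactly the defect K.
  have e1 : ∀ q : (ℝ × WithLp 2 (E × E)) × E,
      (chi s (q.1.2.fst + q.2) - chi s q.1.2.fst) * (chi r (q.1.2.snd + q.2) - chi r q.1.2.snd) =
      (chi s q.1.2.fst * chi r q.1.2.snd) * ((chi s q.2 - 1) * (chi r q.2 - 1)) := fun q => by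
    simp only [chi_add_right]; ring
  simp_rw [e1]
  rw [jump, integral_prod_mul (fun y : ℝ × WithLp 2 (E × E) => chi s y.2.fst * chi r y.2.snd)
    (fun u => (chi s u - 1) * (chi r u - 1)), h.integral_chi_mixture, h.isIDLaw.charFun_eq_exp,
    h.isIDLaw.charFun_eq_exp, h.isIDLaw.charFun_eq_exp, h.isLevyMeasure.levyExp_add]
  change _ * levyCross ν s r = _
  set K := levyCross ν s r
  set a := ((inner ℝ s γ : ℝ) : ℂ) * Complex.I + levyExp ν s
  set b := ((inner ℝ r γ : ℝ) : ℂ) * Complex.I + levyExp ν r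
  -- Keeping the factor K inside the derivative avoids dividing by K, which may vanish.
  have hd : ∀ z : ℝ, HasDerivAt (fun z : ℝ => Complex.exp (a + b + z * K))
      (Complex.exp (a + b + z * K) * K) z := fun z => by
    have h1 : HasDerivAt (fun z : ℝ => a + b + (z : ℂ) * K) K z := by
      have := ((Complex.ofRealCLM.hasDerivAt (x := z)).mul_const K).const_add (a + b)
      simpa using! this
    exact h1.cexp
  have := intervalIntegral.integral_eq_sub_of_hasDerivAt (a := 0) (b := 1) (fun z _ => hd z)
    ((by fun_prop : Continuous fun z : ℝ => Complex.exp (a + b + z * K) * K).intervalIntegrable _ _)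
  rw [intervalIntegral.integral_mul_const] at this
  rw [this, ← Complex.exp_add]
  congr 2
  · simp only [inner_add_left, Complex.ofReal_add, a, b, K]; push_cast; ring
  · simp

end IsInterpolation

end Interpolation

/-! ### From characters to Schwartz functions by Fourier inversion. -/

section Fourier

open FourierTransform
open scoped SchwartzMap

/-- Fubini's theorem for the integral of a product of two parametric integrals. -/
lemma integral_mul_integral_eq {W T : Type*} [MeasurableSpace W] [MeasurableSpace T]
    {m : Measure W} [SFinite m] {Θ : Measure T} [SFinite Θ] {a b : W → ℂ} {α β : W → T → ℂ}
    {A : W → ℝ} {h : T → ℝ}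
    (ha : AEStronglyMeasurable a m) (hb : AEStronglyMeasurable b m)
    (hα : StronglyMeasurable (Function.uncurry α)) (hβ : StronglyMeasurable (Function.uncurry β))
    (hαb : ∀ w q, ‖α w q‖ ≤ A w * h q) (hβb : ∀ w q, ‖β w q‖ ≤ A w * h q)
    (hai : Integrable (fun w => A w * ‖a w‖) m) (hbi : Integrable (fun w => A w * ‖b w‖) m)
    (hh : Integrable (fun q => h q ^ 2) Θ) :
    ∫ q, (∫ w, a w * α w q ∂m) * (∫ w, b w * β w q ∂m) ∂Θ =
      ∫ w, a w.1 * b w.2 * (∫ q, α w.1 q * β w.2 q ∂Θ) ∂(m.prod m) := by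
  have e1 : ∀ q, (∫ w, a w * α w q ∂m) * (∫ w, b w * β w q ∂m) =
      ∫ w, a w.1 * b w.2 * (α w.1 q * β w.2 q) ∂(m.prod m) := fun q => by
    rw [← integral_prod_mul]
    exact integral_congr_ae (ae_of_all _ fun w => by ring)
  simp_rw [e1]
  rw [integral_integral_swap]
  · exact integral_congr_ae (ae_of_all _ fun w => integral_const_mul _ _)
  -- Each factor supplies one power of `h`, so square integrability suffices. This is what a Lévy
  -- measure offers for `h = min 1 ‖u‖`.
  · have hd : Integrable (fun x : T × (W × W) =>
        h x.1 ^ 2 * ((A x.2.1 * ‖a x.2.1‖) * (A x.2.2 * ‖b x.2.2‖))) (Θ.prod (m.prod m)) :=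
      hh.mul_prod (hai.mul_prod hbi)
    refine hd.mono' ?_ (ae_of_all _ fun x => ?_)
    · have h1 : AEStronglyMeasurable (fun x : T × (W × W) => a x.2.1) (Θ.prod (m.prod m)) :=
        (ha.comp_fst (ν := m)).comp_snd
      have h2 : AEStronglyMeasurable (fun x : T × (W × W) => b x.2.2) (Θ.prod (m.prod m)) :=
        (hb.comp_snd (μ := m)).comp_snd
      have h3 : StronglyMeasurable (fun x : T × (W × W) => α x.2.1 x.1) :=
        hα.comp_measurable (g := fun x : T × (W × W) => (x.2.1, x.1)) (by fun_prop)
      have h4 : StronglyMeasurable (fun x : T × (W × W) => β x.2.2 x.1) :=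
        hβ.comp_measurable (g := fun x : T × (W × W) => (x.2.2, x.1)) (by fun_prop)
      exact (h1.mul h2).mul (h3.mul h4).aestronglyMeasurable
    · simp only [Function.uncurry, norm_mul]
      have := mul_le_mul (hαb x.2.1 x.1) (hβb x.2.2 x.1) (norm_nonneg _)
        ((norm_nonneg _).trans (hαb x.2.1 x.1))
      calc _ ≤ ‖a x.2.1‖ * ‖b x.2.2‖ * (A x.2.1 * h x.1 * (A x.2.2 * h x.1)) :=
            mul_le_mul_of_nonneg_left this (by positivity)
        _ = _ := by ring

variable {E : Type*} [NormedAddCommGroup E] [InnerProductSpace ℝ E] [FiniteDimensional ℝ E]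
  [MeasurableSpace E] [BorelSpace E]

lemma schwartz_eq_integral_chi (f : 𝓢(E, ℂ)) (x : E) :
    f x = ∫ w, 𝓕 f w * chi ((2 * Real.pi) • w) x := by
  have h : 𝓕⁻ (𝓕 f) x = f x := by rw [FourierTransform.fourierInv_fourier_eq]
  rw [← h, SchwartzMap.fourierInv_coe, Real.fourierInv_eq']
  refine integral_congr_ae (ae_of_all _ fun w => ?_)
  simp only [chi, real_inner_smul_left, smul_eq_mul]
  ring

/-- The weight is the frequency-dependent constant of `norm_chi_sub_one_le`. -/
lemma integrable_weight_fourier (f : 𝓢(E, ℂ)) :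
    Integrable (fun w => (2 + ‖(2 * Real.pi) • w‖) * ‖𝓕 f w‖) := by
  have h0 := (SchwartzMap.integrable_pow_mul volume (𝓕 f) 0).const_mul 2
  have h1 := (SchwartzMap.integrable_pow_mul volume (𝓕 f) 1).const_mul (2 * Real.pi)
  refine (h0.add h1).congr (ae_of_all _ fun w => ?_)
  simp only [Pi.add_apply, pow_zero, pow_one, norm_smul, Real.norm_eq_abs, abs_of_pos Real.two_pi_pos]
  ring

lemma schwartz_sub_eq_integral_chi (f : 𝓢(E, ℂ)) (x y : E) :
    f x - f y = ∫ w, 𝓕 f w * (chi ((2 * Real.pi) • w) x - chi ((2 * Real.pi) • w) y) := by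
  have hi : ∀ x, Integrable (fun w => 𝓕 f w * chi ((2 * Real.pi) • w) x) := fun x => by
    refine (SchwartzMap.integrable (𝓕 f)).norm.mono' ?_ (ae_of_all _ fun w => by simp)
    have : Continuous fun w => 𝓕 f w := (𝓕 f).continuous
    exact (by fun_prop : Continuous fun w => 𝓕 f w * chi ((2 * Real.pi) • w) x).aestronglyMeasurable
  simp_rw [mul_sub]
  rw [integral_sub (hi x) (hi y), ← schwartz_eq_integral_chi, ← schwartz_eq_integral_chi]

variable {γ : E} {ν μ : Measure E} {ρ : ℝ → Measure (WithLp 2 (E × E))}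

lemma IsInterpolation.integrable_jump_min_sq (h : IsInterpolation γ ν μ ρ) :
    Integrable (fun q => (min 1 ‖q.2‖) ^ 2) h.jump := by
  have := h.isLevyMeasure.sFinite
  simpa using! (integrable_const (μ := h.mixture) (1 : ℝ)).mul_prod
    h.isLevyMeasure.integrable_min_sq

/-- The covariance identity for Schwartz functions. -/
lemma IsInterpolation.integral_jump_schwartz (h : IsInterpolation γ ν μ ρ) (f g : 𝓢(E, ℂ)) :
    ∫ q, (f (q.1.2.fst + q.2) - f q.1.2.fst) * (g (q.1.2.snd + q.2) - g q.1.2.snd) ∂h.jump =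
      ∫ x, f x * g x ∂μ - (∫ x, f x ∂μ) * ∫ x, g x ∂μ := by
  have := h.isLevyMeasure.sFinite
  have := h.isIDLaw.isProbabilityMeasure
  have : SFinite h.jump := by unfold jump; infer_instance
  have hfm : AEStronglyMeasurable (fun w => 𝓕 f w) volume := (𝓕 f).continuous.aestronglyMeasurable
  have hgm : AEStronglyMeasurable (fun w => 𝓕 g w) volume := (𝓕 g).continuous.aestronglyMeasurable
  -- The weight is wasteful for plain characters, but it lets one Fubini lemma serve with `h = 1`
  -- here and with `h = min 1 ‖u‖` for increments.
  have one_le : ∀ w x : E, ‖chi ((2 * Real.pi) • w) x‖ ≤ (2 + ‖(2 * Real.pi) • w‖) * 1 :=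
    fun w x => by rw [norm_chi]; linarith [norm_nonneg ((2 * Real.pi) • w)]
  have c1 : Continuous fun p : E × E => chi ((2 * Real.pi) • p.1) p.2 := by fun_prop
  have c2 : Continuous fun p : E × (E × E) => chi ((2 * Real.pi) • p.1) p.2.1 := by fun_prop
  have c3 : Continuous fun p : E × (E × E) => chi ((2 * Real.pi) • p.1) p.2.2 := by fun_prop
  have c4 : Continuous fun p : E × ((ℝ × WithLp 2 (E × E)) × E) =>
    chi ((2 * Real.pi) • p.1) (p.2.1.2.fst + p.2.2) - chi ((2 * Real.pi) • p.1) p.2.1.2.fst := by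
    fun_prop
  have c5 : Continuous fun p : E × ((ℝ × WithLp 2 (E × E)) × E) =>
    chi ((2 * Real.pi) • p.1) (p.2.1.2.snd + p.2.2) - chi ((2 * Real.pi) • p.1) p.2.1.2.snd := by
    fun_prop
  have sub_le : ∀ w x u : E, ‖chi ((2 * Real.pi) • w) (x + u) - chi ((2 * Real.pi) • w) x‖ ≤
      (2 + ‖(2 * Real.pi) • w‖) * min 1 ‖u‖ := fun w x u => by
    rw [chi_add_right, ← mul_sub_one, norm_mul, norm_chi, one_mul]
    exact norm_chi_sub_one_le _ _
  have I1 : ∫ x, f x * g x ∂μ = ∫ w, 𝓕 f w.1 * 𝓕 g w.2 *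
      charFun μ ((2 * Real.pi) • w.1 + (2 * Real.pi) • w.2) ∂((volume : Measure E).prod volume) := by
    simp_rw [schwartz_eq_integral_chi f, schwartz_eq_integral_chi g, charFun_eq_integral_chi,
      chi_add_left]
    exact integral_mul_integral_eq (h := fun _ => 1) (A := fun w => 2 + ‖(2 * Real.pi) • w‖)
      hfm hgm c1.stronglyMeasurable c1.stronglyMeasurable one_le one_le
      (integrable_weight_fourier f) (integrable_weight_fourier g) (integrable_const _)
  have I2 : (∫ x, f x ∂μ) * ∫ x, g x ∂μ = ∫ w, 𝓕 f w.1 * 𝓕 g w.2 *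
      (charFun μ ((2 * Real.pi) • w.1) * charFun μ ((2 * Real.pi) • w.2))
        ∂((volume : Measure E).prod volume) := by
    have e1 : ∀ w : E × E, charFun μ ((2 * Real.pi) • w.1) * charFun μ ((2 * Real.pi) • w.2) =
        ∫ p, chi ((2 * Real.pi) • w.1) p.1 * chi ((2 * Real.pi) • w.2) p.2 ∂(μ.prod μ) := fun w => by
      rw [charFun_eq_integral_chi, charFun_eq_integral_chi, ← integral_prod_mul]
    rw [← integral_prod_mul]
    simp_rw [e1, schwartz_eq_integral_chi f, schwartz_eq_integral_chi g]
    exact integral_mul_integral_eq (Θ := μ.prod μ) (h := fun _ => 1)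
      (A := fun w => 2 + ‖(2 * Real.pi) • w‖)
      (α := fun w (p : E × E) => chi ((2 * Real.pi) • w) p.1)
      (β := fun w (p : E × E) => chi ((2 * Real.pi) • w) p.2)
      hfm hgm c2.stronglyMeasurable c3.stronglyMeasurable (fun w p => one_le w p.1)
      (fun w p => one_le w p.2)
      (integrable_weight_fourier f) (integrable_weight_fourier g) (integrable_const _)
  have hfg : Integrable (fun w : E × E => 𝓕 f w.1 * 𝓕 g w.2) ((volume : Measure E).prod volume) :=
    (SchwartzMap.integrable (𝓕 f)).mul_prod (SchwartzMap.integrable (𝓕 g))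
  have hcf : Continuous (charFun μ) := continuous_charFun
  rw [I1, I2, ← integral_sub]
  · simp_rw [schwartz_sub_eq_integral_chi f, schwartz_sub_eq_integral_chi g]
    rw [integral_mul_integral_eq (h := fun q => min 1 ‖q.2‖)
      (A := fun w => 2 + ‖(2 * Real.pi) • w‖)
      (α := fun w (q : (ℝ × WithLp 2 (E × E)) × E) =>
        chi ((2 * Real.pi) • w) (q.1.2.fst + q.2) - chi ((2 * Real.pi) • w) q.1.2.fst)
      (β := fun w (q : (ℝ × WithLp 2 (E × E)) × E) =>
        chi ((2 * Real.pi) • w) (q.1.2.snd + q.2) - chi ((2 * Real.pi) • w) q.1.2.snd)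
      hfm hgm c4.stronglyMeasurable c5.stronglyMeasurable (fun w p => sub_le w _ _)
      (fun w p => sub_le w _ _) (integrable_weight_fourier f) (integrable_weight_fourier g)
      h.integrable_jump_min_sq]
    refine integral_congr_ae (ae_of_all _ fun w => ?_)
    simp only [h.integral_jump_chi]
    ring
  · refine hfg.mul_bdd (c := 1) ?_ (ae_of_all _ fun w => norm_charFun_le_one _)
    exact (by fun_prop : Continuous fun w : E × E =>
      charFun μ ((2 * Real.pi) • w.1 + (2 * Real.pi) • w.2)).aestronglyMeasurable
  · refine hfg.mul_bdd (c := 1) ?_ (ae_of_all _ fun w => ?_)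
    · exact (by fun_prop : Continuous fun w : E × E =>
        charFun μ ((2 * Real.pi) • w.1) * charFun μ ((2 * Real.pi) • w.2)).aestronglyMeasurable
    · rw [norm_mul]
      exact mul_le_one₀ (norm_charFun_le_one _) (norm_nonneg _) (norm_charFun_le_one _)

end Fourier

/-! ### From Schwartz functions to bounded Lipschitz functions. -/

section Lipschitz

open scoped SchwartzMap ContDiff Convolution

variable {E : Type*} [NormedAddCommGroup E] [InnerProductSpace ℝ E] [FiniteDimensional ℝ E]
  [MeasurableSpace E] [BorelSpace E]

/-- Mollification of a bounded Lipschitz function with compact support. -/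
lemma exists_contDiff_approx {f : E → ℝ} {B K : ℝ} (hB : ∀ x, |f x| ≤ B)
    (hK : ∀ x y, |f x - f y| ≤ K * ‖x - y‖) (hf : Continuous f) (hc : HasCompactSupport f)
    {ε : ℝ} (hε : 0 < ε) (hK0 : 0 ≤ K) :
    ∃ F : E → ℝ, ContDiff ℝ ∞ F ∧ HasCompactSupport F ∧ (∀ x, |F x| ≤ B) ∧
      (∀ x y, |F x - F y| ≤ K * ‖x - y‖) ∧ ∀ x, |F x - f x| ≤ K * ε := by
  let φ : ContDiffBump (0 : E) := ⟨ε / 2, ε, by positivity, by linarith⟩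
  have hφi : Integrable (φ.normed volume) (volume : Measure E) := φ.integrable_normed
  have hconv : ∀ x, (φ.normed volume ⋆[ContinuousLinearMap.lsmul ℝ ℝ, volume] f) x =
      ∫ t, φ.normed volume t * f (x - t) := fun x => by
    simp [MeasureTheory.convolution]
  have hint : ∀ x, Integrable (fun t => φ.normed volume t * f (x - t)) := fun x => by
    refine hφi.mul_bdd (c := B) (by fun_prop : Continuous fun t => f (x - t)).aestronglyMeasurable
      (ae_of_all _ fun t => hB _)
  have hbd : ∀ (k : E → ℝ) (C : ℝ), (∀ t, |k t| ≤ C) →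
      |∫ t, φ.normed volume t * k t| ≤ C := fun k C hk => by
    have : ‖∫ t, φ.normed volume t * k t‖ ≤ ∫ t, φ.normed volume t * C := by
      refine norm_integral_le_of_norm_le (hφi.mul_const C) (ae_of_all _ fun t => ?_)
      rw [norm_mul, Real.norm_of_nonneg (φ.nonneg_normed t)]
      exact mul_le_mul_of_nonneg_left (hk t) (φ.nonneg_normed t)
    rwa [integral_mul_const, φ.integral_normed, one_mul] at this
  refine ⟨φ.normed volume ⋆[ContinuousLinearMap.lsmul ℝ ℝ, volume] f, ?_, ?_, ?_, ?_, ?_⟩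
  · exact φ.hasCompactSupport_normed.contDiff_convolution_left _ φ.contDiff_normed
      hf.locallyIntegrable
  · exact φ.hasCompactSupport_normed.convolution _ hc
  · intro x
    rw [hconv]
    exact hbd _ _ fun t => hB _
  · intro x y
    rw [hconv, hconv, ← integral_sub (hint x) (hint y)]
    simp_rw [← mul_sub]
    refine hbd _ _ fun t => (hK _ _).trans_eq ?_
    congr 2; abel
  · intro x
    refine φ.dist_normed_convolution_le hf.aestronglyMeasurable fun y hy => ?_
    refine (hK y x).trans ?_
    rw [← dist_eq_norm]
    exact mul_le_mul_of_nonneg_left (Metric.mem_ball.1 hy).le hK0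

/-- Bounded Lipschitz functions are pointwise limits of uniformly bounded, uniformly Lipschitz
Schwartz functions. -/
lemma exists_schwartz_approx {f : E → ℝ} {B K : ℝ} (hB : ∀ x, |f x| ≤ B)
    (hK : ∀ x y, |f x - f y| ≤ K * ‖x - y‖) (hK0 : 0 ≤ K) :
    ∃ F : ℕ → 𝓢(E, ℂ), (∀ n x, ‖F n x‖ ≤ B) ∧
      (∀ n x y, ‖F n x - F n y‖ ≤ (B + K) * ‖x - y‖) ∧
      ∀ x, Tendsto (fun n => F n x) atTop (𝓝 (f x : ℂ)) := by
  have hB0 : 0 ≤ B := (abs_nonneg _).trans (hB 0)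
  have hf : Continuous f := by
    refine (LipschitzWith.of_dist_le_mul (K := ⟨K, hK0⟩) fun x y => ?_).continuous
    rw [Real.dist_eq, dist_eq_norm]; exact hK x y
  -- A 1-Lipschitz cutoff, equal to 1 on the ball of radius n and to 0 beyond n + 1. The product
  -- with f is then (B + K)-Lipschitz, uniformly in n.
  let c : ℕ → E → ℝ := fun n x => max 0 (min 1 ((n : ℝ) + 1 - ‖x‖))
  have c0 : ∀ n x, 0 ≤ c n x := fun n x => le_max_left _ _
  have c1 : ∀ n x, c n x ≤ 1 := fun n x => max_le zero_le_one (min_le_left _ _)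
  have cl : ∀ n x y, |c n x - c n y| ≤ ‖x - y‖ := fun n x y => by
    refine (abs_max_sub_max_le_max _ _ _ _).trans ?_
    refine max_le (by simp) ((abs_min_sub_min_le_max _ _ _ _).trans (max_le (by simp) ?_))
    have : (n : ℝ) + 1 - ‖x‖ - ((n : ℝ) + 1 - ‖y‖) = ‖y‖ - ‖x‖ := by ring
    rw [this, abs_sub_comm]
    exact abs_norm_sub_norm_le x y
  have cc : ∀ n, HasCompactSupport fun x => c n x * f x := fun n => by
    refine HasCompactSupport.intro (isCompact_closedBall (0 : E) (n + 1)) fun x hx => ?_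
    have : (n : ℝ) + 1 < ‖x‖ := by simpa using hx
    have : c n x = 0 := max_eq_left ((min_le_right _ _).trans (by linarith))
    rw [this, zero_mul]
  have cf : ∀ n, Continuous fun x => c n x * f x := fun n => by fun_prop
  have hb : ∀ n x, |c n x * f x| ≤ B := fun n x => by
    rw [abs_mul, abs_of_nonneg (c0 n x)]
    nlinarith [c1 n x, c0 n x, hB x, abs_nonneg (f x)]
  have hl : ∀ n x y, |c n x * f x - c n y * f y| ≤ (B + K) * ‖x - y‖ := fun n x y => by
    have e : c n x * f x - c n y * f y = (c n x - c n y) * f x + c n y * (f x - f y) := by ring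
    rw [e]
    refine (abs_add_le _ _).trans ?_
    rw [abs_mul, abs_mul, abs_of_nonneg (c0 n y), add_mul]
    refine add_le_add ?_ ?_
    · rw [mul_comm B]
      exact mul_le_mul (cl n x y) (hB x) (abs_nonneg _) (norm_nonneg _)
    · exact (mul_le_of_le_one_left (abs_nonneg _) (c1 n y)).trans (hK x y)
  choose F Fs Fc Fb Fl Fa using fun n : ℕ => exists_contDiff_approx (hb n) (hl n) (cf n) (cc n)
    (ε := 1 / ((n : ℝ) + 1)) (by positivity) (by positivity)
  let G : ℕ → 𝓢(E, ℂ) := fun n =>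
    HasCompactSupport.toSchwartzMap (f := fun x => ((F n x : ℝ) : ℂ))
      ((Fc n).comp_left (g := ((↑) : ℝ → ℂ)) Complex.ofReal_zero)
      (Complex.ofRealCLM.contDiff.comp (Fs n))
  have hG : ∀ n x, G n x = ((F n x : ℝ) : ℂ) := fun n x => rfl
  refine ⟨G, fun n x => ?_, fun n x y => ?_, fun x => ?_⟩
  · rw [hG, Complex.norm_real]; exact Fb n x
  · rw [hG, hG, ← Complex.ofReal_sub, Complex.norm_real]; exact Fl n x y
  · simp_rw [hG]
    refine (Complex.continuous_ofReal.tendsto _).comp ?_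
    rw [tendsto_iff_dist_tendsto_zero]
    have hlim : Tendsto (fun n : ℕ => (B + K) * (1 / ((n : ℝ) + 1))) atTop (𝓝 0) := by
      simpa using tendsto_one_div_add_atTop_nhds_zero_nat.const_mul (B + K)
    refine tendsto_of_tendsto_of_tendsto_of_le_of_le' tendsto_const_nhds hlim
      (Eventually.of_forall fun n => dist_nonneg) ?_
    obtain ⟨N, hN⟩ := exists_nat_ge ‖x‖
    filter_upwards [eventually_ge_atTop N] with n hn
    have h1 : c n x = 1 := by
      have : (N : ℝ) ≤ n := by exact_mod_cast hn
      have : min 1 ((n : ℝ) + 1 - ‖x‖) = 1 := min_eq_left (by linarith)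
      simp [c, this]
    have := Fa n x
    rwa [h1, one_mul] at this

/-- Boundedness controls large jumps and the Lipschitz property small ones. A product of two such
increments is therefore ν-integrable. -/
lemma norm_sub_le_min {F : Type*} [NormedAddCommGroup F] {f : E → F} {B K : ℝ} (hB0 : 0 ≤ B)
    (hK0 : 0 ≤ K) (hB : ∀ x, ‖f x‖ ≤ B) (hK : ∀ x y, ‖f x - f y‖ ≤ K * ‖x - y‖) (x u : E) :
    ‖f (x + u) - f x‖ ≤ (2 * B + K) * min 1 ‖u‖ := by
  rcases le_total 1 ‖u‖ with h | h
  · rw [min_eq_left h]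
    linarith [norm_sub_le (f (x + u)) (f x), hB (x + u), hB x]
  · rw [min_eq_right h]
    have := hK (x + u) x
    rw [add_sub_cancel_left] at this
    nlinarith [norm_nonneg u]

variable {γ : E} {ν μ : Measure E} {ρ : ℝ → Measure (WithLp 2 (E × E))}

lemma norm_cross_le {F : Type*} [NormedRing F] {f g : E → F} {C D : ℝ}
    (hC0 : 0 ≤ C) (hC : ∀ x u, ‖f (x + u) - f x‖ ≤ C * min 1 ‖u‖)
    (hD : ∀ x u, ‖g (x + u) - g x‖ ≤ D * min 1 ‖u‖) (x y u : E) :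
    ‖(f (x + u) - f x) * (g (y + u) - g y)‖ ≤ C * D * (min 1 ‖u‖) ^ 2 := by
  refine (norm_mul_le _ _).trans ?_
  calc _ ≤ (C * min 1 ‖u‖) * (D * min 1 ‖u‖) :=
        mul_le_mul (hC _ _) (hD _ _) (norm_nonneg _) (by positivity)
    _ = _ := by ring

lemma continuous_of_abs_sub_le {f : E → ℝ} {K : ℝ} (hK : ∀ x y, |f x - f y| ≤ K * ‖x - y‖) :
    Continuous f := by
  refine (LipschitzWith.of_dist_le_mul (K := K.toNNReal) fun x y => ?_).continuous
  rw [Real.dist_eq, dist_eq_norm]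
  exact (hK x y).trans (mul_le_mul_of_nonneg_right (Real.le_coe_toNNReal K) (norm_nonneg _))

/-- The increments of bounded Lipschitz functions are jointly integrable. -/
lemma IsInterpolation.integrable_jump (h : IsInterpolation γ ν μ ρ) {f g : E → ℝ}
    {B K : ℝ} (hK0 : 0 ≤ K) (hfB : ∀ x, |f x| ≤ B) (hfK : ∀ x y, |f x - f y| ≤ K * ‖x - y‖)
    (hgB : ∀ x, |g x| ≤ B) (hgK : ∀ x y, |g x - g y| ≤ K * ‖x - y‖) :
    Integrable (fun q => (f (q.1.2.fst + q.2) - f q.1.2.fst) *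
      (g (q.1.2.snd + q.2) - g q.1.2.snd)) h.jump := by
  have hB0 : 0 ≤ B := (abs_nonneg _).trans (hfB 0)
  have hfc : Continuous f := continuous_of_abs_sub_le hfK
  have hgc : Continuous g := continuous_of_abs_sub_le hgK
  refine (h.integrable_jump_min_sq.const_mul ((2 * B + K) * (2 * B + K))).mono'
    (by fun_prop : Continuous fun q : (ℝ × WithLp 2 (E × E)) × E =>
      (f (q.1.2.fst + q.2) - f q.1.2.fst) *
      (g (q.1.2.snd + q.2) - g q.1.2.snd)).aestronglyMeasurable (ae_of_all _ fun q => ?_)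
  exact norm_cross_le (by positivity) (norm_sub_le_min hB0 hK0 hfB hfK)
    (norm_sub_le_min hB0 hK0 hgB hgK) _ _ _

/-- The covariance identity for bounded Lipschitz functions. -/
theorem IsInterpolation.integral_jump_lipschitz (h : IsInterpolation γ ν μ ρ) {f g : E → ℝ}
    {B K : ℝ} (hK0 : 0 ≤ K) (hfB : ∀ x, |f x| ≤ B) (hfK : ∀ x y, |f x - f y| ≤ K * ‖x - y‖)
    (hgB : ∀ x, |g x| ≤ B) (hgK : ∀ x y, |g x - g y| ≤ K * ‖x - y‖) :
    ∫ q, (f (q.1.2.fst + q.2) - f q.1.2.fst) * (g (q.1.2.snd + q.2) - g q.1.2.snd) ∂h.jump =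
      ∫ x, f x * g x ∂μ - (∫ x, f x ∂μ) * ∫ x, g x ∂μ := by
  have hB0 : 0 ≤ B := (abs_nonneg _).trans (hfB 0)
  have := h.isIDLaw.isProbabilityMeasure
  obtain ⟨F, FB, FK, Fl⟩ := exists_schwartz_approx hfB hfK hK0
  obtain ⟨G, GB, GK, Gl⟩ := exists_schwartz_approx hgB hgK hK0
  have Fc : ∀ n, Continuous (F n) := fun n => (F n).continuous
  have Gc : ∀ n, Continuous (G n) := fun n => (G n).continuous
  have L1 := tendsto_integral_of_dominated_convergence (μ := h.jump)
    (F := fun n q => (F n (q.1.2.fst + q.2) - F n q.1.2.fst) *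
      (G n (q.1.2.snd + q.2) - G n q.1.2.snd))
    (f := fun q => ((f (q.1.2.fst + q.2) : ℂ) - f q.1.2.fst) *
      (g (q.1.2.snd + q.2) - g q.1.2.snd))
    (fun q => (2 * B + (B + K)) * (2 * B + (B + K)) * (min 1 ‖q.2‖) ^ 2)
    (fun n => (by have := Fc n; have := Gc n; fun_prop :
      Continuous fun q : (ℝ × WithLp 2 (E × E)) × E =>
        (F n (q.1.2.fst + q.2) - F n q.1.2.fst) *
          (G n (q.1.2.snd + q.2) - G n q.1.2.snd)).aestronglyMeasurable)
    (h.integrable_jump_min_sq.const_mul _)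
    (fun n => ae_of_all _ fun q => norm_cross_le (by positivity)
      (norm_sub_le_min hB0 (by positivity) (FB n) (FK n))
      (norm_sub_le_min hB0 (by positivity) (GB n) (GK n)) _ _ _)
    (ae_of_all _ fun q => ((Fl _).sub (Fl _)).mul ((Gl _).sub (Gl _)))
  have L2 := tendsto_integral_of_dominated_convergence (μ := μ)
    (F := fun n x => F n x * G n x) (f := fun x => (f x : ℂ) * g x) (fun _ => B * B)
    (fun n => ((Fc n).mul (Gc n)).aestronglyMeasurable) (integrable_const _)
    (fun n => ae_of_all _ fun x => by
      rw [norm_mul]; exact mul_le_mul (FB n x) (GB n x) (norm_nonneg _) hB0)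
    (ae_of_all _ fun x => (Fl x).mul (Gl x))
  have L3 := tendsto_integral_of_dominated_convergence (μ := μ)
    (F := fun n x => F n x) (f := fun x => (f x : ℂ)) (fun _ => B)
    (fun n => (Fc n).aestronglyMeasurable) (integrable_const _)
    (fun n => ae_of_all _ fun x => FB n x) (ae_of_all _ fun x => Fl x)
  have L4 := tendsto_integral_of_dominated_convergence (μ := μ)
    (F := fun n x => G n x) (f := fun x => (g x : ℂ)) (fun _ => B)
    (fun n => (Gc n).aestronglyMeasurable) (integrable_const _)
    (fun n => ae_of_all _ fun x => GB n x) (ae_of_all _ fun x => Gl x)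
  have L5 := L2.sub (L3.mul L4)
  simp_rw [← h.integral_jump_schwartz] at L5
  have key := tendsto_nhds_unique L1 L5
  simp only [← Complex.ofReal_sub, ← Complex.ofReal_mul, integral_complex_ofReal] at key
  exact_mod_cast key

end Lipschitz

/-! ### Independent components: the Lévy measure lives on the axes. -/

section Axes

variable {d : ℕ} {Ω : Type*} [MeasurableSpace Ω] {P : Measure Ω} [IsProbabilityMeasure P]
  {X : Ω → EuclideanSpace ℝ (Fin d)} {γ : EuclideanSpace ℝ (Fin d)}
  {ν : Measure (EuclideanSpace ℝ (Fin d))}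

lemma inner_smul_unitVec (k : Fin d) (s : ℝ) (x : EuclideanSpace ℝ (Fin d)) :
    inner ℝ (s • unitVec k) x = s * x k := by
  simp [unitVec, real_inner_smul_left, EuclideanSpace.inner_single_left]

lemma charFun_add_of_iIndepFun (hX : AEMeasurable X P)
    (hindep : iIndepFun (fun (k : Fin d) (ω : Ω) => X ω k) P) {j k : Fin d} (hjk : j ≠ k)
    (s r : ℝ) :
    charFun (P.map X) (s • unitVec j + r • unitVec k) =
      charFun (P.map X) (s • unitVec j) * charFun (P.map X) (r • unitVec k) := by
  have hm : ∀ t, ∫ x, chi t x ∂(P.map X) = ∫ ω, chi t (X ω) ∂P := fun t =>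
    integral_map hX (by fun_prop : Continuous fun x => chi t x).aestronglyMeasurable
  simp_rw [charFun_eq_integral_chi, hm, chi_add_left]
  let e : ℝ → ℝ → ℂ := fun s x => Complex.exp (((s * x : ℝ) : ℂ) * Complex.I)
  have he : ∀ s, Continuous (e s) := fun s => by fun_prop
  have hchi : ∀ (s : ℝ) (k : Fin d) x, chi (s • unitVec k) x = e s (x k) := fun s k x => by
    simp only [chi, inner_smul_unitVec, e]
  simp_rw [hchi]
  have hi := (hindep.indepFun hjk).comp (he s).measurable (he r).measurable
  have hXk : ∀ k : Fin d, AEMeasurable (fun ω => X ω k) P := fun k =>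
    (by fun_prop : Measurable fun x : EuclideanSpace ℝ (Fin d) => x k).comp_aemeasurable hX
  exact hi.integral_fun_mul_eq_mul_integral
    ((he s).measurable.comp_aemeasurable (hXk j)).aestronglyMeasurable
    ((he r).measurable.comp_aemeasurable (hXk k)).aestronglyMeasurable

/-- Independence makes the exponential of the defect equal to 1. Comparing moduli avoids the 2πi
ambiguity of the logarithm, and the real part is all that is needed. -/
lemma re_levyCross_eq_zero (hX : AEMeasurable X P) (hID : IsIDLaw trunc γ ν (P.map X))
    (hindep : iIndepFun (fun (k : Fin d) (ω : Ω) => X ω k) P) {j k : Fin d} (hjk : j ≠ k)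
    (s r : ℝ) : (levyCross ν (s • unitVec j) (r • unitVec k)).re = 0 := by
  have h := charFun_add_of_iIndepFun hX hindep hjk s r
  rw [hID.charFun_eq_exp, hID.charFun_eq_exp, hID.charFun_eq_exp, hID.isLevyMeasure.levyExp_add,
    ← Complex.exp_add, inner_add_left, Complex.ofReal_add] at h
  have h2 := congrArg norm h
  simp only [Complex.norm_exp, Complex.add_re, Complex.mul_re, Complex.add_im,
    Complex.ofReal_re, Complex.ofReal_im, Complex.I_re, Complex.I_im, Real.exp_eq_exp] at h2
  linarith

/-- Averaging the real part of the defect integrand over r and -r cancels its sin·sin term. What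
remains is nonnegative with integral zero. -/
lemma one_sub_cos_mul_ae_eq_zero (hX : AEMeasurable X P) (hID : IsIDLaw trunc γ ν (P.map X))
    (hindep : iIndepFun (fun (k : Fin d) (ω : Ω) => X ω k) P) {j k : Fin d} (hjk : j ≠ k)
    (s r : ℝ) :
    (fun u : EuclideanSpace ℝ (Fin d) => (1 - Real.cos (s * u j)) * (1 - Real.cos (r * u k)))
      =ᵐ[ν] 0 := by
  have i1 := hID.isLevyMeasure.integrable_chi_cross (s • unitVec j) (r • unitVec k)
  have i2 := hID.isLevyMeasure.integrable_chi_cross (s • unitVec j) ((-r) • unitVec k)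
  have key : ∀ u : EuclideanSpace ℝ (Fin d),
      (1 - Real.cos (s * u j)) * (1 - Real.cos (r * u k)) =
      (1 / 2) * (((chi (s • unitVec j) u - 1) * (chi (r • unitVec k) u - 1)).re +
        ((chi (s • unitVec j) u - 1) * (chi ((-r) • unitVec k) u - 1)).re) := fun u => by
    simp only [chi, inner_smul_unitVec, Complex.exp_ofReal_mul_I, Complex.mul_re,
      Complex.sub_re, Complex.add_re, Complex.sub_im, Complex.add_im, Complex.ofReal_re,
      Complex.ofReal_im, Complex.I_re, Complex.I_im, Complex.one_re, Complex.one_im, neg_mul,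
      Real.cos_neg, Real.sin_neg, Complex.mul_im]
    ring
  have hi : Integrable (fun u : EuclideanSpace ℝ (Fin d) =>
      (1 - Real.cos (s * u j)) * (1 - Real.cos (r * u k))) ν := by
    simp_rw [key]
    exact (i1.re.add i2.re).const_mul _
  refine (integral_eq_zero_iff_of_nonneg (fun u => mul_nonneg
    (by linarith [Real.cos_le_one (s * u j)]) (by linarith [Real.cos_le_one (r * u k)])) hi).1 ?_
  simp_rw [key]
  have e1 := integral_re i1
  have e2 := integral_re i2
  simp only [RCLike.re_to_complex] at e1 e2
  have e3 := integral_add i1.re i2.re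
  simp only [RCLike.re_to_complex] at e3
  rw [integral_const_mul, e3]
  change 1 / 2 * (∫ u, ((chi (s • unitVec j) u - 1) * (chi (r • unitVec k) u - 1)).re ∂ν +
    ∫ u, ((chi (s • unitVec j) u - 1) * (chi ((-r) • unitVec k) u - 1)).re ∂ν) = 0
  rw [e1, e2]
  have z1 := re_levyCross_eq_zero hX hID hindep hjk s r
  have z2 := re_levyCross_eq_zero hX hID hindep hjk s (-r)
  unfold levyCross at z1 z2
  rw [z1, z2]; norm_num

/-- The Lévy measure of a vector with independent components is carried by the axes. -/
lemma ae_mul_coord_eq_zero (hX : AEMeasurable X P) (hID : IsIDLaw trunc γ ν (P.map X))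
    (hindep : iIndepFun (fun (k : Fin d) (ω : Ω) => X ω k) P) :
    ∀ᵐ u ∂ν, ∀ j k : Fin d, j ≠ k → u j = 0 ∨ u k = 0 := by
  refine ae_all_iff.2 fun j => ae_all_iff.2 fun k => ?_
  by_cases hjk : j = k
  · exact ae_of_all _ fun u h => absurd hjk h
  -- Countably many frequencies keep a single null set. For n beyond |u_j| and |u_k| both arguments
  -- lie in (-1, 1), where the cosine equals 1 only at 0.
  have h : ∀ᵐ u ∂ν, ∀ n : ℕ, (1 - Real.cos ((1 / ((n : ℝ) + 1)) * u j)) *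
      (1 - Real.cos ((1 / ((n : ℝ) + 1)) * u k)) = 0 :=
    ae_all_iff.2 fun n => one_sub_cos_mul_ae_eq_zero hX hID hindep hjk _ _
  filter_upwards [h] with u hu _
  obtain ⟨n, hn⟩ := exists_nat_ge (max |u j| |u k|)
  have small : ∀ y : ℝ, |y| ≤ n → 1 - Real.cos ((1 / ((n : ℝ) + 1)) * y) = 0 → y = 0 := by
    intro y hy hc
    have hn0 : (0 : ℝ) < (n : ℝ) + 1 := by positivity
    have hlt : |1 / ((n : ℝ) + 1) * y| < 1 := by
      rw [abs_mul, abs_of_pos (by positivity), one_div, inv_mul_lt_iff₀ hn0]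
      linarith
    have h2 := abs_lt.1 hlt
    have := (Real.cos_eq_one_iff_of_lt_of_lt (by linarith [Real.pi_gt_three])
      (by linarith [Real.pi_gt_three])).1 (sub_eq_zero.1 hc).symm
    rcases mul_eq_zero.1 this with h3 | h3
    · exact absurd h3 (by positivity)
    · exact h3
  rcases mul_eq_zero.1 (hu n) with h1 | h1
  · exact Or.inl (small _ ((le_max_left _ _).trans hn) h1)
  · exact Or.inr (small _ ((le_max_right _ _).trans hn) h1)

lemma measurable_coord (k : Fin d) : Measurable fun x : EuclideanSpace ℝ (Fin d) => x k := by
  fun_prop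

lemma coordLevy_eq_map (ν : Measure (EuclideanSpace ℝ (Fin d))) (k : Fin d) :
    coordLevy ν k = (ν.restrict {x | x k ≠ 0}).map fun x => x k := by
  rw [coordLevy, Measure.restrict_map (measurable_coord k) (by measurability)]
  rfl

lemma integrable_coordLevy {h : ℝ → ℝ} (hm : Measurable h) {k : Fin d}
    (hi : Integrable (fun x => h (x k)) ν) : Integrable h (coordLevy ν k) := by
  rw [coordLevy_eq_map, integrable_map_measure hm.aestronglyMeasurable
    (measurable_coord k).aemeasurable]
  exact hi.restrict

lemma integral_coordLevy {h : ℝ → ℝ} (hm : Measurable h) (h0 : h 0 = 0) (k : Fin d) :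
    ∫ u, h u ∂(coordLevy ν k) = ∫ x, h (x k) ∂ν := by
  rw [coordLevy_eq_map, integral_map (measurable_coord k).aemeasurable hm.aestronglyMeasurable]
  exact setIntegral_eq_integral_of_forall_compl_eq_zero fun x hx => by
    have : x k = 0 := by simpa using hx
    rw [this, h0]

lemma abs_coord_le (x : EuclideanSpace ℝ (Fin d)) (k : Fin d) : |x k| ≤ ‖x‖ :=
  EuclideanSpace.norm_eq x ▸ Real.abs_le_sqrt (by
    have := Finset.single_le_sum (f := fun i => ‖x i‖ ^ 2) (fun i _ => by positivity)
      (Finset.mem_univ k)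
    simpa using this)

lemma norm_smul_unitVec (k : Fin d) (u : ℝ) : ‖u • unitVec k‖ = |u| := by
  simp [unitVec, norm_smul]

/-- Integration with respect to a Lévy measure carried by the axes. -/
lemma integral_eq_sum_coordLevy (hν : IsLevyMeasure ν)
    (hax : ∀ᵐ u ∂ν, ∀ j k : Fin d, j ≠ k → u j = 0 ∨ u k = 0)
    {h : EuclideanSpace ℝ (Fin d) → ℝ} (hc : Continuous h) {C : ℝ} (hC0 : 0 ≤ C)
    (hC : ∀ u, |h u| ≤ C * (min 1 ‖u‖) ^ 2) :
    ∫ u, h u ∂ν = ∑ k, ∫ u, h (u • unitVec k) ∂(coordLevy ν k) := by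
  have h0 : h 0 = 0 := by simpa using hC 0
  have hcont : ∀ k : Fin d, Continuous fun u : ℝ => h (u • unitVec k) := fun k => by fun_prop
  have hint : ∀ k : Fin d, Integrable (fun x : EuclideanSpace ℝ (Fin d) => h (x k • unitVec k)) ν :=
    fun k => by
      refine hν.integrable_of_norm_le ((hcont k).measurable.comp
        (measurable_coord k)).aestronglyMeasurable C fun x => ?_
      refine (hC _).trans (mul_le_mul_of_nonneg_left ?_ hC0)
      rw [norm_smul_unitVec]
      have := abs_coord_le x k
      gcongr
  have e : ∀ k : Fin d, ∫ u, h (u • unitVec k) ∂(coordLevy ν k) =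
      ∫ x, h (x k • unitVec k) ∂ν := fun k =>
    integral_coordLevy (h := fun u => h (u • unitVec k)) (hcont k).measurable (by simp [h0]) k
  simp_rw [e]
  rw [← integral_finsetSum _ fun k _ => hint k]
  refine integral_congr_ae ?_
  filter_upwards [hax] with x hx
  -- A nonzero point of the axes has one nonzero coordinate; all other summands equal h 0 = 0.
  by_cases hx0 : x = 0
  · simp [hx0, h0]
  obtain ⟨k, hk⟩ : ∃ k, x k ≠ 0 := by
    by_contra hcon
    push Not at hcon
    exact hx0 (by ext i; simpa using hcon i)
  have hz : ∀ j, j ≠ k → x j = 0 := fun j hj => (hx j k hj).resolve_right hk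
  rw [Finset.sum_eq_single k (fun j _ hj => by simp [hz j hj, h0]) (by simp)]
  congr 1
  ext i
  by_cases hi : i = k
  · subst hi; simp [unitVec]
  · simp [unitVec, hz i hi, hi]

end Axes

/-! ### Truncation of real values. -/

section Truncation

/-- Truncation of a real number at the levels `±n`. -/
def clampAt (n : ℕ) (y : ℝ) : ℝ := max (-(n : ℝ)) (min n y)

@[fun_prop]
lemma continuous_clampAt (n : ℕ) : Continuous (clampAt n) := by unfold clampAt; fun_prop

lemma abs_clampAt_le_nat (n : ℕ) (y : ℝ) : |clampAt n y| ≤ n :=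
  abs_le.2 ⟨le_max_left _ _, max_le (by linarith [(Nat.cast_nonneg n : (0 : ℝ) ≤ n)])
    (min_le_left _ _)⟩

lemma abs_clampAt_le_abs (n : ℕ) (y : ℝ) : |clampAt n y| ≤ |y| := by
  have hn : (0 : ℝ) ≤ n := Nat.cast_nonneg n
  refine abs_le.2 ⟨?_, ?_⟩
  · exact le_max_of_le_right (le_min (by linarith [abs_nonneg y]) (neg_abs_le y))
  · exact max_le (by linarith [abs_nonneg y]) ((min_le_right _ _).trans (le_abs_self y))

lemma abs_clampAt_sub_le (n : ℕ) (x y : ℝ) : |clampAt n x - clampAt n y| ≤ |x - y| :=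
  (abs_max_sub_max_le_max _ _ _ _).trans (max_le (by simp)
    ((abs_min_sub_min_le_max _ _ _ _).trans (max_le (by simp) le_rfl)))

lemma monotone_clampAt (n : ℕ) : Monotone (clampAt n) := fun _ _ hab =>
  max_le_max le_rfl (min_le_min le_rfl hab)

lemma tendsto_clampAt (y : ℝ) : Tendsto (fun n => clampAt n y) atTop (𝓝 y) := by
  obtain ⟨N, hN⟩ := exists_nat_ge |y|
  refine tendsto_const_nhds.congr' ?_
  filter_upwards [eventually_ge_atTop N] with n hn
  have hn' : |y| ≤ n := hN.trans (by exact_mod_cast hn)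
  have := abs_le.1 hn'
  rw [clampAt, min_eq_right this.2, max_eq_right this.1]

end Truncation

/-! ### Exponential moments of the Lévy measure. -/

section ExponentialMoments

variable {E : Type*} [NormedAddCommGroup E] [InnerProductSpace ℝ E] [FiniteDimensional ℝ E]
  [MeasurableSpace E] [BorelSpace E]
  {γ : E} {ν μ : Measure E} {ρ : ℝ → Measure (WithLp 2 (E × E))}

lemma abs_exp_sub_exp_le {a b M : ℝ} (ha : a ≤ M) (hb : b ≤ M) :
    |Real.exp a - Real.exp b| ≤ Real.exp M * |a - b| := by
  wlog hab : b ≤ a generalizing a b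
  · rw [abs_sub_comm, abs_sub_comm a]
    exact this hb ha (le_of_not_ge hab)
  rw [abs_of_nonneg (sub_nonneg.2 (Real.exp_le_exp.2 hab)), abs_of_nonneg (sub_nonneg.2 hab)]
  have h1 : Real.exp b = Real.exp a * Real.exp (b - a) := by rw [← Real.exp_add]; ring_nf
  have h2 := Real.add_one_le_exp (b - a)
  have h3 : Real.exp a ≤ Real.exp M := Real.exp_le_exp.2 ha
  have h4 := Real.exp_pos a
  calc Real.exp a - Real.exp b = Real.exp a * (1 - Real.exp (b - a)) := by rw [h1]; ring
    _ ≤ Real.exp a * (a - b) := mul_le_mul_of_nonneg_left (by linarith) h4.le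
    _ ≤ _ := mul_le_mul_of_nonneg_right h3 (by linarith)

lemma mul_exp_sub_one_nonneg (x : ℝ) : 0 ≤ x * (Real.exp x - 1) := by
  rcases le_total 0 x with h | h
  · exact mul_nonneg h (by linarith [Real.add_one_le_exp x])
  · exact mul_nonneg_of_nonpos_of_nonpos h (by linarith [Real.exp_le_one_iff.2 h])

/-- Both increments have the sign of a. This lets the covariance identity be read as a lower
integral, ready for Fatou's lemma. -/
lemma sub_mul_sub_nonneg_of_monotone {φ ψ : ℝ → ℝ} (hφ : Monotone φ) (hψ : Monotone ψ)
    (x y a : ℝ) : 0 ≤ (φ (x + a) - φ x) * (ψ (y + a) - ψ y) := by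
  rcases le_total 0 a with h | h
  · exact mul_nonneg (sub_nonneg.2 (hφ (by linarith))) (sub_nonneg.2 (hψ (by linarith)))
  · exact mul_nonneg_of_nonpos_of_nonpos (sub_nonpos.2 (hφ (by linarith)))
      (sub_nonpos.2 (hψ (by linarith)))

/-- Exponential moments of an infinitely divisible law pass to its Lévy measure. -/
theorem IsInterpolation.integrable_mul_exp_sub_one (h : IsInterpolation γ ν μ ρ) (l : E →L[ℝ] ℝ)
    (h1 : Integrable (fun x => |l x| * Real.exp (l x)) μ)
    (h2 : Integrable (fun x => Real.exp (l x)) μ) (h3 : Integrable (fun x => |l x|) μ) :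
    Integrable (fun u => l u * (Real.exp (l u) - 1)) ν := by
  have := h.isIDLaw.isProbabilityMeasure
  have := h.isLevyMeasure.sFinite
  -- Cutting the exponent only from above already gives a bounded Lipschitz function of l, and keeps
  -- it monotone and below e^y.
  let ψ : ℕ → ℝ → ℝ := fun n y => Real.exp (min n y)
  have ψm : ∀ n, Monotone (ψ n) := fun n a b hab => Real.exp_le_exp.2 (min_le_min le_rfl hab)
  have ψc : ∀ n, Continuous (ψ n) := fun n => by fun_prop
  have n_le : ∀ n : ℕ, (n : ℝ) ≤ Real.exp n := fun n => by linarith [Real.add_one_le_exp (n : ℝ)]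
  have clampB : ∀ n y, |clampAt n y| ≤ Real.exp n := fun n y =>
    (abs_clampAt_le_nat n y).trans (n_le n)
  have ψB : ∀ n y, |ψ n y| ≤ Real.exp n := fun n y => by
    rw [abs_of_pos (Real.exp_pos _)]; exact Real.exp_le_exp.2 (min_le_left _ _)
  have ψle : ∀ n y, ψ n y ≤ Real.exp y := fun n y => Real.exp_le_exp.2 (min_le_right _ _)
  have minl : ∀ (n : ℕ) (x y : ℝ), |min (n : ℝ) x - min (n : ℝ) y| ≤ |x - y| := fun n x y =>
    (abs_min_sub_min_le_max _ _ _ _).trans (max_le (by simp) le_rfl)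
  have ll : ∀ x y : E, |l x - l y| ≤ ‖l‖ * ‖x - y‖ := fun x y => by
    rw [← map_sub]; exact l.le_opNorm _
  have clampK : ∀ (n : ℕ) (x y : E), |clampAt n (l x) - clampAt n (l y)| ≤ Real.exp n * ‖l‖ * ‖x - y‖ := by
    intro n x y
    refine ((abs_clampAt_sub_le _ _ _).trans (ll x y)).trans ?_
    rw [mul_assoc]
    exact le_mul_of_one_le_left (by positivity) (Real.one_le_exp (Nat.cast_nonneg n))
  have ψK : ∀ (n : ℕ) (x y : E), |ψ n (l x) - ψ n (l y)| ≤ Real.exp n * ‖l‖ * ‖x - y‖ := by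
    intro n x y
    refine (abs_exp_sub_exp_le (min_le_left _ _) (min_le_left _ _)).trans ?_
    rw [mul_assoc]
    exact mul_le_mul_of_nonneg_left ((minl _ _ _).trans (ll x y)) (Real.exp_pos _).le
  have bound : ∀ n : ℕ, ∫⁻ q, ENNReal.ofReal ((clampAt n (l (q.1.2.fst + q.2)) - clampAt n (l q.1.2.fst)) *
      (ψ n (l (q.1.2.snd + q.2)) - ψ n (l q.1.2.snd))) ∂h.jump ≤
      ENNReal.ofReal (∫ x, |l x| * Real.exp (l x) ∂μ +
        (∫ x, |l x| ∂μ) * ∫ x, Real.exp (l x) ∂μ) := by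
    intro n
    have hK0 : 0 ≤ Real.exp n * ‖l‖ := by positivity
    have hi := h.integrable_jump (f := fun x => clampAt n (l x)) (g := fun x => ψ n (l x)) hK0
      (fun x => clampB n _) (clampK n) (fun x => ψB n _) (ψK n)
    rw [← ofReal_integral_eq_lintegral_ofReal hi (ae_of_all _ fun q => by
      simpa using! sub_mul_sub_nonneg_of_monotone (monotone_clampAt n) (ψm n) (l q.1.2.fst) (l q.1.2.snd)
        (l q.2)),
      h.integral_jump_lipschitz (f := fun x => clampAt n (l x)) (g := fun x => ψ n (l x)) hK0
      (fun x => clampB n _) (clampK n) (fun x => ψB n _) (ψK n)]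
    refine ENNReal.ofReal_le_ofReal ?_
    have hφi : Integrable (fun x => clampAt n (l x)) μ := h3.mono'
      ((continuous_clampAt n).comp l.continuous).aestronglyMeasurable (ae_of_all _ fun x => abs_clampAt_le_abs n _)
    have hψi : Integrable (fun x => ψ n (l x)) μ := h2.mono'
      ((ψc n).comp l.continuous).aestronglyMeasurable (ae_of_all _ fun x => by
        rw [Real.norm_of_nonneg (Real.exp_pos _).le]; exact ψle n _)
    have a1 : ∫ x, clampAt n (l x) * ψ n (l x) ∂μ ≤ ∫ x, |l x| * Real.exp (l x) ∂μ := by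
      have hle : ∀ x, |clampAt n (l x) * ψ n (l x)| ≤ |l x| * Real.exp (l x) := fun x => by
        rw [abs_mul, abs_of_pos (Real.exp_pos _ : 0 < ψ n (l x))]
        exact mul_le_mul (abs_clampAt_le_abs n _) (ψle n _) (Real.exp_pos _).le (abs_nonneg _)
      exact integral_mono (h1.mono' (((continuous_clampAt n).comp l.continuous).mul
        ((ψc n).comp l.continuous)).aestronglyMeasurable (ae_of_all _ hle)) h1
        fun x => (le_abs_self _).trans (hle x)
    have a2 : |∫ x, clampAt n (l x) ∂μ| ≤ ∫ x, |l x| ∂μ :=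
      norm_integral_le_of_norm_le (f := fun x => clampAt n (l x)) h3 (ae_of_all _ fun x => abs_clampAt_le_abs n _)
    have a3 : ∫ x, ψ n (l x) ∂μ ≤ ∫ x, Real.exp (l x) ∂μ :=
      integral_mono hψi h2 fun x => ψle n _
    have a4 : 0 ≤ ∫ x, ψ n (l x) ∂μ := integral_nonneg fun x => (Real.exp_pos _).le
    have a5 := mul_le_mul a2 a3 a4 ((abs_nonneg _).trans a2)
    have a6 := neg_abs_le (∫ x, clampAt n (l x) ∂μ)
    nlinarith
  have lim : ∫⁻ q, ENNReal.ofReal (Real.exp (l q.1.2.snd)) *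
      ENNReal.ofReal (l q.2 * (Real.exp (l q.2) - 1)) ∂h.jump ≤
      ENNReal.ofReal (∫ x, |l x| * Real.exp (l x) ∂μ +
        (∫ x, |l x| ∂μ) * ∫ x, Real.exp (l x) ∂μ) := by
    refine le_trans ?_ ((lintegral_liminf_le (μ := h.jump)
      (f := fun (n : ℕ) q => ENNReal.ofReal ((clampAt n (l (q.1.2.fst + q.2)) - clampAt n (l q.1.2.fst)) *
      (ψ n (l (q.1.2.snd + q.2)) - ψ n (l q.1.2.snd)))) fun n => ?_).trans
      ((liminf_le_liminf (Eventually.of_forall bound)).trans (liminf_const (f := (atTop : Filter ℕ)) _).le))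
    · refine lintegral_mono fun q => ?_
      refine (Tendsto.liminf_eq ?_).ge
      have ψt : ∀ y, Tendsto (fun n => ψ n y) atTop (𝓝 (Real.exp y)) := fun y => by
        obtain ⟨N, hN⟩ := exists_nat_ge |y|
        refine tendsto_const_nhds.congr' ?_
        filter_upwards [eventually_ge_atTop N] with n hn
        have hn' : |y| ≤ n := hN.trans (by exact_mod_cast hn)
        simp only [ψ]
        rw [min_eq_right (abs_le.1 hn').2]
      rw [← ENNReal.ofReal_mul (Real.exp_pos _).le]
      have := ((tendsto_clampAt (l (q.1.2.fst + q.2))).sub (tendsto_clampAt (l q.1.2.fst))).mul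
        ((ψt (l (q.1.2.snd + q.2))).sub (ψt (l q.1.2.snd)))
      -- By linearity of l the limit splits into a function of V times a function of the jump.
      have e : (l (q.1.2.fst + q.2) - l q.1.2.fst) *
          (Real.exp (l (q.1.2.snd + q.2)) - Real.exp (l q.1.2.snd)) =
          Real.exp (l q.1.2.snd) * (l q.2 * (Real.exp (l q.2) - 1)) := by
        simp only [map_add, Real.exp_add]; ring
      rw [e] at this
      exact ENNReal.tendsto_ofReal this
    · have := ψc n
      exact (by fun_prop : Continuous fun q : (ℝ × WithLp 2 (E × E)) × E =>
        ((clampAt n (l (q.1.2.fst + q.2)) - clampAt n (l q.1.2.fst)) *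
      (ψ n (l (q.1.2.snd + q.2)) - ψ n (l q.1.2.snd)))).measurable.ennreal_ofReal
  have m1 : Measurable fun y : ℝ × WithLp 2 (E × E) => ENNReal.ofReal (Real.exp (l y.2.snd)) :=
    (by fun_prop : Continuous fun y : ℝ × WithLp 2 (E × E) =>
      Real.exp (l y.2.snd)).measurable.ennreal_ofReal
  have c2 : Continuous fun u : E => l u * (Real.exp (l u) - 1) := by fun_prop
  rw [jump, lintegral_prod_mul (f := fun y : ℝ × WithLp 2 (E × E) =>
    ENNReal.ofReal (Real.exp (l y.2.snd))) (g := fun u =>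
    ENNReal.ofReal (l u * (Real.exp (l u) - 1))) m1.aemeasurable
    c2.measurable.ennreal_ofReal.aemeasurable] at lim
  refine ⟨c2.aestronglyMeasurable, ?_⟩
  rw [hasFiniteIntegral_iff_ofReal (ae_of_all _ fun u => mul_exp_sub_one_nonneg _)]
  have hfin := lim.trans_lt ENNReal.ofReal_lt_top
  -- A finite product with a nonzero first factor has a finite second factor.
  have hne : ∫⁻ y, ENNReal.ofReal (Real.exp (l y.2.snd)) ∂h.mixture ≠ 0 := by
    intro h0
    rw [lintegral_eq_zero_iff m1] at h0
    obtain ⟨y, hy⟩ := h0.exists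
    simp [(Real.exp_pos _).not_ge] at hy
  exact ENNReal.lt_top_of_mul_ne_top_right hfin.ne hne

end ExponentialMoments

/-! ### Elementary inequalities for the exponential. -/

section RealExp

/-- The slack s - t absorbs the linear factor; the strict inequality t < M provides it. -/
lemma mul_exp_le {s t y : ℝ} (hts : t < s) :
    y * Real.exp (t * y) ≤ (s - t)⁻¹ * Real.exp (s * y) := by
  have h0 : 0 < s - t := sub_pos.2 hts
  have h1 : (s - t) * y ≤ Real.exp ((s - t) * y) := by linarith [Real.add_one_le_exp ((s - t) * y)]
  have h2 : Real.exp (s * y) = Real.exp ((s - t) * y) * Real.exp (t * y) := by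
    rw [← Real.exp_add]; ring_nf
  rw [h2, ← mul_assoc]
  refine mul_le_mul_of_nonneg_right ?_ (Real.exp_pos _).le
  rw [inv_mul_eq_div, le_div_iff₀ h0]
  linarith

lemma integrable_mul_exp_of_lt {α : Type*} [MeasurableSpace α] {m : Measure α} {y : α → ℝ}
    (hm : AEStronglyMeasurable y m) (hy : ∀ x, 0 ≤ y x) {s t : ℝ} (hts : t < s)
    (hs : Integrable (fun x => Real.exp (s * y x)) m) :
    Integrable (fun x => y x * Real.exp (t * y x)) m := by
  refine (hs.const_mul (s - t)⁻¹).mono'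
    (hm.mul (Real.continuous_exp.comp_aestronglyMeasurable (hm.const_mul t)))
    (ae_of_all _ fun x => ?_)
  rw [Real.norm_of_nonneg (mul_nonneg (hy x) (Real.exp_pos _).le)]
  exact mul_exp_le hts

lemma integrable_exp_of_le {α : Type*} [MeasurableSpace α] {m : Measure α} {y : α → ℝ}
    (hm : AEStronglyMeasurable y m) (hy : ∀ x, 0 ≤ y x) {s t : ℝ} (hts : t ≤ s)
    (hs : Integrable (fun x => Real.exp (s * y x)) m) :
    Integrable (fun x => Real.exp (t * y x)) m := by
  refine hs.mono' (Real.continuous_exp.comp_aestronglyMeasurable (hm.const_mul t))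
    (ae_of_all _ fun x => ?_)
  rw [Real.norm_of_nonneg (Real.exp_pos _).le]
  exact Real.exp_le_exp.2 (mul_le_mul_of_nonneg_right hts (hy x))

/-- By convexity the exponential lies below its chord over [0, c]. -/
lemma exp_sub_one_mul_le {a c : ℝ} (ha : 0 ≤ a) (hac : a ≤ c) (hc : 0 < c) :
    Real.exp a - 1 ≤ a * ((Real.exp c - 1) / c) := by
  have h1 : a / c ≤ 1 := (div_le_one hc).2 hac
  have h := convexOn_exp.2 (mem_univ (0 : ℝ)) (mem_univ c) (sub_nonneg.2 h1)
    (div_nonneg ha hc.le) (by ring)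
  simp only [smul_eq_mul, mul_zero, zero_add, Real.exp_zero, mul_one, div_mul_cancel₀ a hc.ne'] at h
  have e : a * ((Real.exp c - 1) / c) = a / c * (Real.exp c - 1) := by ring
  rw [e]; linarith

lemma abs_exp_sub_one_le_exp_abs (x : ℝ) : |Real.exp x - 1| ≤ Real.exp |x| - 1 := by
  rcases le_total 0 x with h | h
  · rw [abs_of_nonneg h, abs_of_nonneg (by linarith [Real.add_one_le_exp x])]
  · rw [abs_of_nonpos h, abs_of_nonpos (by linarith [Real.exp_le_one_iff.2 h])]
    linarith [Real.add_one_le_exp x, Real.add_one_le_exp (-x)]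

/-- Source of the quotient in `integrand`. At β = 0 the increment δ vanishes too, so division by
zero is harmless. -/
lemma abs_exp_mul_sub_one_le {t δ β : ℝ} (ht : 0 ≤ t) (hδ : |δ| ≤ β) :
    |Real.exp (t * δ) - 1| ≤ |δ| * ((Real.exp (t * β) - 1) / β) := by
  rcases eq_or_lt_of_le ht with h0 | h0
  · simp [← h0]
  rcases eq_or_lt_of_le ((abs_nonneg δ).trans hδ) with hβ | hβ
  · have : δ = 0 := by simpa using hδ.trans hβ.ge
    simp [this]
  · refine (abs_exp_sub_one_le_exp_abs _).trans ?_
    rw [abs_mul, abs_of_pos h0]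
    refine (exp_sub_one_mul_le (by positivity) (mul_le_mul_of_nonneg_left hδ ht)
      (mul_pos h0 hβ)).trans_eq ?_
    field_simp

lemma sq_mul_exp_sub_one_div (t β : ℝ) :
    β ^ 2 * ((Real.exp (t * β) - 1) / β) = β * (Real.exp (t * β) - 1) := by
  by_cases h : β = 0
  · simp [h]
  · field_simp

lemma exp_sub_one_div_nonneg {t β : ℝ} (ht : 0 ≤ t) (hβ : 0 ≤ β) :
    0 ≤ (Real.exp (t * β) - 1) / β :=
  div_nonneg (by linarith [Real.add_one_le_exp (t * β), mul_nonneg ht hβ]) hβ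

end RealExp

/-! ### From coordinatewise to global Lipschitz bounds. -/

section CoordLipschitz

variable {d : ℕ} {f : EuclideanSpace ℝ (Fin d) → ℝ} {b : Fin d → ℝ}

lemma coordLip_nonneg
    (hLip : ∀ (k : Fin d) (u : ℝ) (x : EuclideanSpace ℝ (Fin d)),
      |f (x + u • unitVec k) - f x| ≤ b k * |u|) (k : Fin d) : 0 ≤ b k := by
  have := (abs_nonneg _).trans (hLip k 1 0)
  simpa using this

/-- Moves the coordinates one at a time and telescopes. -/
lemma abs_sub_le_sum_coord
    (hLip : ∀ (k : Fin d) (u : ℝ) (x : EuclideanSpace ℝ (Fin d)),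
      |f (x + u • unitVec k) - f x| ≤ b k * |u|) (x v : EuclideanSpace ℝ (Fin d)) :
    |f (x + v) - f x| ≤ ∑ k, b k * |v k| := by
  have h : ∀ s : Finset (Fin d),
      |f (x + ∑ k ∈ s, v k • unitVec k) - f x| ≤ ∑ k ∈ s, b k * |v k| := by
    intro s
    induction s using Finset.induction_on with
    | empty => simp
    | insert k s hk ih =>
      rw [Finset.sum_insert hk, Finset.sum_insert hk, add_comm (v k • unitVec k), ← add_assoc]
      calc _ ≤ |f (x + ∑ k ∈ s, v k • unitVec k + v k • unitVec k)
            - f (x + ∑ k ∈ s, v k • unitVec k)| +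
            |f (x + ∑ k ∈ s, v k • unitVec k) - f x| := abs_sub_le _ _ _
        _ ≤ _ := add_le_add (hLip k _ _) ih
  have e : ∑ k, v k • unitVec k = v := by
    ext i
    simp [unitVec, Finset.sum_apply, Pi.single_apply]
  have := h Finset.univ
  rwa [e] at this

lemma abs_sub_le_sum_mul_norm
    (hLip : ∀ (k : Fin d) (u : ℝ) (x : EuclideanSpace ℝ (Fin d)),
      |f (x + u • unitVec k) - f x| ≤ b k * |u|) (x y : EuclideanSpace ℝ (Fin d)) :
    |f x - f y| ≤ (∑ k, b k) * ‖x - y‖ := by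
  have := abs_sub_le_sum_coord hLip y (x - y)
  rw [add_sub_cancel] at this
  refine this.trans ?_
  rw [Finset.sum_mul]
  exact Finset.sum_le_sum fun k _ =>
    mul_le_mul_of_nonneg_left (abs_coord_le _ k) (coordLip_nonneg hLip k)

end CoordLipschitz

/-! ### Exponential moments of the coordinate Lévy measures. -/

section CoordMoments

variable {d : ℕ} {γ : EuclideanSpace ℝ (Fin d)}
  {ν μ : Measure (EuclideanSpace ℝ (Fin d))}
  {ρ : ℝ → Measure (WithLp 2 (EuclideanSpace ℝ (Fin d) × EuclideanSpace ℝ (Fin d)))}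

/-- Combines the linear forms ±tβx_k: since v(e^v - 1) ≥ 0 for either sign, their sum dominates
|v|(e^{|v|} - 1). -/
lemma IsInterpolation.integrable_coordLevy_mul_exp (h : IsInterpolation γ ν μ ρ) (k : Fin d)
    {β s t : ℝ} (hβ : 0 ≤ β) (ht : 0 ≤ t) (hts : t < s)
    (hs : Integrable (fun x => Real.exp (s * (β * |x k|))) μ) :
    Integrable (fun u : ℝ => β * |u| * (Real.exp (t * (β * |u|)) - 1)) (coordLevy ν k) := by
  have hcm : Continuous fun x : EuclideanSpace ℝ (Fin d) => β * |x k| := by fun_prop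
  have hc0 : ∀ x : EuclideanSpace ℝ (Fin d), 0 ≤ β * |x k| := fun x => by positivity
  have e1 := integrable_exp_of_le hcm.aestronglyMeasurable hc0 hts.le hs
  have e2 := (integrable_mul_exp_of_lt hcm.aestronglyMeasurable hc0 hts hs).const_mul t
  have e3 := (integrable_mul_exp_of_lt hcm.aestronglyMeasurable hc0 (ht.trans_lt hts) hs).const_mul t
  have one_side : ∀ c : ℝ, |c| = t * β →
      Integrable (fun x : EuclideanSpace ℝ (Fin d) => c * x k * (Real.exp (c * x k) - 1)) ν := by
    intro c hc
    have habs : ∀ x : EuclideanSpace ℝ (Fin d), |c * x k| = t * (β * |x k|) := fun x => by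
      rw [abs_mul, hc]; ring
    have hle : ∀ x : EuclideanSpace ℝ (Fin d),
        Real.exp (c * x k) ≤ Real.exp (t * (β * |x k|)) := fun x =>
      Real.exp_le_exp.2 ((le_abs_self _).trans_eq (habs x))
    refine h.integrable_mul_exp_sub_one (c • EuclideanSpace.proj k) ?_ ?_ ?_
    · change Integrable (fun x : EuclideanSpace ℝ (Fin d) => |c * x k| * Real.exp (c * x k)) μ
      refine e2.mono' (by fun_prop : Continuous fun x : EuclideanSpace ℝ (Fin d) =>
        |c * x k| * Real.exp (c * x k)).aestronglyMeasurable (ae_of_all _ fun x => ?_)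
      rw [Real.norm_of_nonneg (by positivity), habs]
      exact (mul_le_mul_of_nonneg_left (hle x) (mul_nonneg ht (hc0 x))).trans_eq (mul_assoc _ _ _)
    · refine e1.mono' (by fun_prop : Continuous fun x : EuclideanSpace ℝ (Fin d) =>
        Real.exp (c * x k)).aestronglyMeasurable (ae_of_all _ fun x => ?_)
      rw [Real.norm_of_nonneg (Real.exp_pos _).le]
      exact hle x
    · refine e3.congr (ae_of_all _ fun x => ?_)
      change _ = |c * x k|
      simp only [habs, zero_mul, Real.exp_zero, mul_one]
  rcases eq_or_lt_of_le ht with h0 | h0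
  · simp [← h0]
  have htb : 0 ≤ t * β := by positivity
  -- The factor `t⁻¹` turns the prefactor tβ|u| back into β|u|.
  have hsum := ((one_side (t * β) (abs_of_nonneg htb)).add
    (one_side (-(t * β)) (by rw [abs_neg, abs_of_nonneg htb]))).const_mul t⁻¹
  refine integrable_coordLevy (by fun_prop) (hsum.mono'
    (by fun_prop : Continuous fun x : EuclideanSpace ℝ (Fin d) =>
      β * |x k| * (Real.exp (t * (β * |x k|)) - 1)).aestronglyMeasurable (ae_of_all _ fun x => ?_))
  have key : ∀ v : ℝ, |v| * (Real.exp |v| - 1) ≤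
      v * (Real.exp v - 1) + -v * (Real.exp (-v) - 1) := fun v => by
    rcases abs_choice v with hv | hv <;> rw [hv] <;>
      linarith [mul_exp_sub_one_nonneg v, mul_exp_sub_one_nonneg (-v)]
  have hv := key (t * β * x k)
  rw [abs_mul, abs_of_nonneg htb] at hv
  have hnn : 0 ≤ Real.exp (t * (β * |x k|)) - 1 := by
    linarith [Real.add_one_le_exp (t * (β * |x k|)), mul_nonneg ht (hc0 x)]
  rw [Real.norm_of_nonneg (mul_nonneg (hc0 x) hnn), inv_mul_eq_div, le_div_iff₀ h0]
  simp only [Pi.add_apply, neg_mul] at hv ⊢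
  refine le_trans (le_of_eq ?_) hv
  rw [mul_assoc t β]; ring

end CoordMoments

/-! ### The energy functional and the inequality, first truncated, then in the limit. -/

section Entropy

variable {d : ℕ} {γ : EuclideanSpace ℝ (Fin d)}
  {ν μ : Measure (EuclideanSpace ℝ (Fin d))}
  {ρ : ℝ → Measure (WithLp 2 (EuclideanSpace ℝ (Fin d) × EuclideanSpace ℝ (Fin d)))}
  {f : EuclideanSpace ℝ (Fin d) → ℝ} {b : Fin d → ℝ} {t : ℝ}

/-- The factor of `integrand` which does not depend on the size of `f`. -/
def energyDensity (f : EuclideanSpace ℝ (Fin d) → ℝ) (b : Fin d → ℝ) (t : ℝ) (k : Fin d)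
    (x y : EuclideanSpace ℝ (Fin d)) (u : ℝ) : ℝ :=
  (|f (x + u • unitVec k) - f x| ^ 2 + |f (y + u • unitVec k) - f y| ^ 2) / 2
    * ((Real.exp (t * (b k * |u|)) - 1) / (b k * |u|))

lemma integrand_eq (k : Fin d) (x y : EuclideanSpace ℝ (Fin d)) (u : ℝ) :
    integrand f b t k x y u = energyDensity f b t k x y u * Real.exp (t * f y) := by
  simp only [integrand, energyDensity, mul_assoc t]; ring

/-- The sum over the coordinates of the integrated energy densities. -/
def energy (f : EuclideanSpace ℝ (Fin d) → ℝ) (b : Fin d → ℝ) (t : ℝ)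
    (ν : Measure (EuclideanSpace ℝ (Fin d)))
    (p : WithLp 2 (EuclideanSpace ℝ (Fin d) × EuclideanSpace ℝ (Fin d))) : ℝ :=
  ∑ k, ∫ u, energyDensity f b t k p.fst p.snd u ∂(coordLevy ν k)

lemma sum_integral_integrand_eq
    (p : WithLp 2 (EuclideanSpace ℝ (Fin d) × EuclideanSpace ℝ (Fin d))) :
    ∑ k, ∫ u, integrand f b t k p.fst p.snd u ∂(coordLevy ν k) =
      energy f b t ν p * Real.exp (t * f p.snd) := by
  simp_rw [integrand_eq, integral_mul_const, energy, Finset.sum_mul]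

variable (hLip : ∀ (k : Fin d) (u : ℝ) (x : EuclideanSpace ℝ (Fin d)),
      |f (x + u • unitVec k) - f x| ≤ b k * |u|)

include hLip

lemma continuous_of_coordLip : Continuous f :=
  continuous_of_abs_sub_le (abs_sub_le_sum_mul_norm hLip)

lemma energyDensity_nonneg (ht : 0 ≤ t) (k : Fin d) (x y : EuclideanSpace ℝ (Fin d)) (u : ℝ) :
    0 ≤ energyDensity f b t k x y u :=
  mul_nonneg (by positivity)
    (exp_sub_one_div_nonneg ht (mul_nonneg (coordLip_nonneg hLip k) (abs_nonneg u)))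

/-- The bound does not involve x or y, so the energy is a bounded function of (U, V). -/
lemma energyDensity_le (ht : 0 ≤ t) (k : Fin d) (x y : EuclideanSpace ℝ (Fin d)) (u : ℝ) :
    energyDensity f b t k x y u ≤ b k * |u| * (Real.exp (t * (b k * |u|)) - 1) := by
  have hb := mul_nonneg (coordLip_nonneg hLip k) (abs_nonneg u)
  rw [← sq_mul_exp_sub_one_div]
  refine mul_le_mul_of_nonneg_right ?_ (exp_sub_one_div_nonneg ht hb)
  have h1 := pow_le_pow_left₀ (abs_nonneg _) (hLip k u x) 2
  have h2 := pow_le_pow_left₀ (abs_nonneg _) (hLip k u y) 2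
  linarith

lemma measurable_energyDensity (k : Fin d) (x y : EuclideanSpace ℝ (Fin d)) :
    Measurable (energyDensity f b t k x y) := by
  have hf := continuous_of_coordLip hLip
  unfold energyDensity
  refine Continuous.measurable (by fun_prop) |>.mul (Measurable.div ?_ ?_) <;>
  exact Continuous.measurable (by fun_prop)

variable (hw : ∀ k, Integrable
  (fun u : ℝ => b k * |u| * (Real.exp (t * (b k * |u|)) - 1)) (coordLevy ν k))

include hw

lemma integrable_energyDensity (ht : 0 ≤ t) (k : Fin d) (x y : EuclideanSpace ℝ (Fin d)) :
    Integrable (energyDensity f b t k x y) (coordLevy ν k) := by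
  refine (hw k).mono' (measurable_energyDensity hLip k x y).aestronglyMeasurable
    (ae_of_all _ fun u => ?_)
  rw [Real.norm_of_nonneg (energyDensity_nonneg hLip ht k x y u)]
  exact energyDensity_le hLip ht k x y u

lemma continuous_energy (ht : 0 ≤ t) : Continuous (energy f b t ν) := by
  have hf := continuous_of_coordLip hLip
  refine continuous_finsetSum _ fun k _ => ?_
  refine continuous_of_dominated
    (fun p => (measurable_energyDensity hLip k _ _).aestronglyMeasurable)
    (fun p => ae_of_all _ fun u => ?_) (hw k) (ae_of_all _ fun u => ?_)
  · rw [Real.norm_of_nonneg (energyDensity_nonneg hLip ht k _ _ u)]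
    exact energyDensity_le hLip ht k _ _ u
  · unfold energyDensity
    fun_prop

lemma abs_energy_le (ht : 0 ≤ t)
    (p : WithLp 2 (EuclideanSpace ℝ (Fin d) × EuclideanSpace ℝ (Fin d))) :
    |energy f b t ν p| ≤
      ∑ k, ∫ u, b k * |u| * (Real.exp (t * (b k * |u|)) - 1) ∂(coordLevy ν k) := by
  rw [abs_of_nonneg (Finset.sum_nonneg fun k _ => integral_nonneg fun u =>
    energyDensity_nonneg hLip ht k _ _ u)]
  exact Finset.sum_le_sum fun k _ => integral_mono (integrable_energyDensity hLip hw ht k _ _)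
    (hw k) fun u => energyDensity_le hLip ht k _ _ u

omit hw in
/-- Pointwise comparison of the increments of a truncated function and of its exponential. -/
lemma abs_clamp_cross_le (ht : 0 ≤ t) (n : ℕ) (k : Fin d) (x y : EuclideanSpace ℝ (Fin d))
    (u : ℝ) :
    |(clampAt n (f (x + u • unitVec k)) - clampAt n (f x)) *
      (Real.exp (t * clampAt n (f (y + u • unitVec k))) - Real.exp (t * clampAt n (f y)))| ≤
      energyDensity f b t k x y u * Real.exp (t * clampAt n (f y)) := by
  set a := f (x + u • unitVec k) - f x
  set c := f (y + u • unitVec k) - f y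
  have ha := abs_clampAt_sub_le n (f (x + u • unitVec k)) (f x)
  have hc := abs_clampAt_sub_le n (f (y + u • unitVec k)) (f y)
  set δ := clampAt n (f (y + u • unitVec k)) - clampAt n (f y) with hδ
  have e : Real.exp (t * clampAt n (f (y + u • unitVec k))) - Real.exp (t * clampAt n (f y)) =
      (Real.exp (t * δ) - 1) * Real.exp (t * clampAt n (f y)) := by
    rw [sub_mul, ← Real.exp_add, hδ]; ring_nf
  have h1 := abs_exp_mul_sub_one_le ht (hc.trans (hLip k u y))
  have h2 := exp_sub_one_div_nonneg ht
    (mul_nonneg (coordLip_nonneg hLip k) (abs_nonneg u))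
  rw [e, abs_mul, abs_mul, abs_of_pos (Real.exp_pos _), ← mul_assoc]
  refine mul_le_mul_of_nonneg_right ?_ (Real.exp_pos _).le
  -- Clamping is 1-Lipschitz, so the increments of f itself dominate. The last step is 2|a||c| ≤ a²
  -- + c².
  calc _ ≤ |a| * (|c| * ((Real.exp (t * (b k * |u|)) - 1) / (b k * |u|))) :=
        mul_le_mul ha (h1.trans (mul_le_mul_of_nonneg_right hc h2)) (abs_nonneg _) (abs_nonneg _)
    _ = (|a| * |c|) * ((Real.exp (t * (b k * |u|)) - 1) / (b k * |u|)) := by ring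
    _ ≤ _ := mul_le_mul_of_nonneg_right (by nlinarith [sq_nonneg (|a| - |c|)]) h2

/-- The inequality for truncations of `f`. -/
lemma IsInterpolation.clamp_inequality (h : IsInterpolation γ ν μ ρ)
    (hax : ∀ᵐ u ∂ν, ∀ j k : Fin d, j ≠ k → u j = 0 ∨ u k = 0) (ht : 0 ≤ t) (n : ℕ) :
    ∫ x, clampAt n (f x) * Real.exp (t * clampAt n (f x)) ∂μ -
      (∫ x, clampAt n (f x) ∂μ) * ∫ x, Real.exp (t * clampAt n (f x)) ∂μ ≤
    ∫ y, energy f b t ν y.2 * Real.exp (t * clampAt n (f y.2.snd)) ∂h.mixture := by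
  have := h.isLevyMeasure.sFinite
  have hf := continuous_of_coordLip hLip
  set L := ∑ k, b k
  have hL0 : 0 ≤ L := Finset.sum_nonneg fun k _ => coordLip_nonneg hLip k
  -- Common constants for the truncation (n and L) and for its exponential (e^{tn} and e^{tn}·tL).
  set B : ℝ := n + Real.exp (t * n)
  set K : ℝ := L + Real.exp (t * n) * (t * L)
  have hn0 : (0 : ℝ) ≤ n := Nat.cast_nonneg n
  have hK0 : 0 ≤ K := by positivity
  have hcl : ∀ x y, |clampAt n (f x) - clampAt n (f y)| ≤ L * ‖x - y‖ := fun x y =>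
    (abs_clampAt_sub_le _ _ _).trans (abs_sub_le_sum_mul_norm hLip x y)
  have htn : ∀ x, t * clampAt n (f x) ≤ t * n := fun x =>
    mul_le_mul_of_nonneg_left ((le_abs_self _).trans (abs_clampAt_le_nat n _)) ht
  have fB : ∀ x, |clampAt n (f x)| ≤ B := fun x =>
    (abs_clampAt_le_nat n _).trans (by linarith [Real.exp_pos (t * n)])
  have fK : ∀ x y, |clampAt n (f x) - clampAt n (f y)| ≤ K * ‖x - y‖ := fun x y =>
    (hcl x y).trans (mul_le_mul_of_nonneg_right (by
      have : 0 ≤ Real.exp (t * n) * (t * L) := by positivity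
      linarith) (norm_nonneg _))
  have gB : ∀ x, |Real.exp (t * clampAt n (f x))| ≤ B := fun x => by
    rw [abs_of_pos (Real.exp_pos _)]
    linarith [Real.exp_le_exp.2 (htn x)]
  have gK : ∀ x y, |Real.exp (t * clampAt n (f x)) - Real.exp (t * clampAt n (f y))| ≤
      K * ‖x - y‖ := fun x y => by
    refine (abs_exp_sub_exp_le (htn x) (htn y)).trans ?_
    rw [← mul_sub, abs_mul, abs_of_nonneg ht]
    have h1 := mul_le_mul_of_nonneg_left (mul_le_mul_of_nonneg_left (hcl x y) ht)
      (Real.exp_pos (t * n)).le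
    have h2 := mul_nonneg hL0 (norm_nonneg (x - y))
    calc _ ≤ _ := h1
      _ ≤ _ := by simp only [K]; linarith
  have hB0 : 0 ≤ B := (abs_nonneg _).trans (fB 0)
  have hij := h.integrable_jump (f := fun x => clampAt n (f x))
    (g := fun x => Real.exp (t * clampAt n (f x))) hK0 fB fK gB gK
  rw [← h.integral_jump_lipschitz (f := fun x => clampAt n (f x))
    (g := fun x => Real.exp (t * clampAt n (f x))) hK0 fB fK gB gK]
  unfold jump at hij ⊢
  rw [integral_prod _ hij]
  have hen := continuous_energy hLip hw ht
  refine integral_mono hij.integral_prod_left ?_ fun y => ?_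
  · refine Integrable.of_bound (C := (∑ k, ∫ u, b k * |u| * (Real.exp (t * (b k * |u|)) - 1)
      ∂(coordLevy ν k)) * B)
      (by fun_prop : Continuous fun y : ℝ × WithLp 2 (EuclideanSpace ℝ (Fin d) ×
        EuclideanSpace ℝ (Fin d)) =>
        energy f b t ν y.2 * Real.exp (t * clampAt n (f y.2.snd))).aestronglyMeasurable
      (ae_of_all _ fun y => ?_)
    rw [norm_mul]
    have h1 := abs_energy_le hLip hw ht y.2
    exact mul_le_mul h1 (gB _) (norm_nonneg _) ((abs_nonneg _).trans h1)
  · have hc : Continuous fun u : EuclideanSpace ℝ (Fin d) =>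
        (clampAt n (f (y.2.fst + u)) - clampAt n (f y.2.fst)) *
        (Real.exp (t * clampAt n (f (y.2.snd + u))) - Real.exp (t * clampAt n (f y.2.snd))) := by
      fun_prop
    simp only []
    rw [integral_eq_sum_coordLevy h.isLevyMeasure hax hc
      (C := (2 * B + K) * (2 * B + K)) (by positivity)
      (fun u => norm_cross_le (f := fun x => clampAt n (f x))
        (g := fun x => Real.exp (t * clampAt n (f x))) (by positivity)
        (norm_sub_le_min (f := fun x => clampAt n (f x)) hB0 hK0 fB fK)
        (norm_sub_le_min (f := fun x => Real.exp (t * clampAt n (f x))) hB0 hK0 gB gK) _ _ _),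
      energy, Finset.sum_mul]
    refine Finset.sum_le_sum fun k _ => ?_
    rw [← integral_mul_const]
    have hi := (integrable_energyDensity hLip hw ht k y.2.fst y.2.snd).mul_const
      (Real.exp (t * clampAt n (f y.2.snd)))
    have hle := abs_clamp_cross_le hLip ht n k y.2.fst y.2.snd
    refine integral_mono (hi.mono' ?_ (ae_of_all _ hle)) hi fun u => (le_abs_self _).trans (hle u)
    exact (hc.comp (by fun_prop : Continuous fun u : ℝ => u • unitVec k)).aestronglyMeasurable

/-- Integrability of the weighted energy with respect to the mixture. -/
lemma IsInterpolation.integrable_energy_mixture (h : IsInterpolation γ ν μ ρ) (ht : 0 ≤ t)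
    (he : Integrable (fun x => Real.exp (t * f x)) μ) :
    Integrable (fun y => energy f b t ν y.2 * Real.exp (t * f y.2.snd)) h.mixture := by
  have hf := continuous_of_coordLip hLip
  have hen := continuous_energy hLip hw ht
  have hsnd : Measurable fun y : ℝ × WithLp 2 (EuclideanSpace ℝ (Fin d) ×
    EuclideanSpace ℝ (Fin d)) => y.2.snd := by fun_prop
  have he' : Integrable (fun y => Real.exp (t * f y.2.snd)) h.mixture := by
    rw [← h.map_snd_mixture] at he
    exact he.comp_measurable hsnd
  exact he'.bdd_mul (by fun_prop : Continuous fun y : ℝ × WithLp 2 (EuclideanSpace ℝ (Fin d) ×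
    EuclideanSpace ℝ (Fin d)) => energy f b t ν y.2).aestronglyMeasurable
    (ae_of_all _ fun y => abs_energy_le hLip hw ht y.2)

/-- Integrability of the weighted energy with respect to each interpolating law. -/
lemma IsInterpolation.integrable_energy_pair (h : IsInterpolation γ ν μ ρ) (ht : 0 ≤ t)
    (he : Integrable (fun x => Real.exp (t * f x)) μ) {z : ℝ} (hz : z ∈ Icc (0 : ℝ) 1) :
    Integrable (fun p => energy f b t ν p * Real.exp (t * f p.snd)) (ρ z) := by
  have hf := continuous_of_coordLip hLip
  have hen := continuous_energy hLip hw ht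
  have hsnd : Measurable fun p : WithLp 2 (EuclideanSpace ℝ (Fin d) ×
    EuclideanSpace ℝ (Fin d)) => p.snd := by fun_prop
  have he' : Integrable (fun p => Real.exp (t * f p.snd)) (ρ z) := by
    rw [← h.map_snd hz] at he
    exact he.comp_measurable hsnd
  exact he'.bdd_mul hen.aestronglyMeasurable (ae_of_all _ fun p => abs_energy_le hLip hw ht p)

/-- The inequality for `f` itself. -/
lemma IsInterpolation.energy_inequality (h : IsInterpolation γ ν μ ρ)
    (hax : ∀ᵐ u ∂ν, ∀ j k : Fin d, j ≠ k → u j = 0 ∨ u k = 0) (ht : 0 ≤ t)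
    (hf0 : ∫ x, f x ∂μ = 0) (hfi : Integrable f μ)
    (he : Integrable (fun x => Real.exp (t * |f x|)) μ)
    (hfe : Integrable (fun x => |f x| * Real.exp (t * |f x|)) μ) :
    ∫ x, f x * Real.exp (t * f x) ∂μ ≤
      ∫ y, energy f b t ν y.2 * Real.exp (t * f y.2.snd) ∂h.mixture := by
  have hf := continuous_of_coordLip hLip
  have hen := continuous_energy hLip hw ht
  have hsnd : Measurable fun y : ℝ × WithLp 2 (EuclideanSpace ℝ (Fin d) ×
    EuclideanSpace ℝ (Fin d)) => y.2.snd := by fun_prop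
  have hexp : ∀ n x, Real.exp (t * clampAt n (f x)) ≤ Real.exp (t * |f x|) := fun n x =>
    Real.exp_le_exp.2 (mul_le_mul_of_nonneg_left
      ((le_abs_self _).trans (abs_clampAt_le_abs n _)) ht)
  have hlim : ∀ x, Tendsto (fun n => Real.exp (t * clampAt n (f x))) atTop
      (𝓝 (Real.exp (t * f x))) := fun x =>
    (Real.continuous_exp.tendsto _).comp ((tendsto_clampAt (f x)).const_mul t)
  have L1 := tendsto_integral_of_dominated_convergence (μ := μ)
    (F := fun n x => clampAt n (f x) * Real.exp (t * clampAt n (f x)))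
    (f := fun x => f x * Real.exp (t * f x)) _
    (fun n => (by fun_prop : Continuous fun x =>
      clampAt n (f x) * Real.exp (t * clampAt n (f x))).aestronglyMeasurable) hfe
    (fun n => ae_of_all _ fun x => by
      rw [norm_mul, Real.norm_of_nonneg (Real.exp_pos _).le]
      exact mul_le_mul (abs_clampAt_le_abs n _) (hexp n x) (Real.exp_pos _).le (abs_nonneg _))
    (ae_of_all _ fun x => (tendsto_clampAt (f x)).mul (hlim x))
  have L2 := tendsto_integral_of_dominated_convergence (μ := μ)
    (F := fun n x => clampAt n (f x)) (f := f) _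
    (fun n => (by fun_prop : Continuous fun x => clampAt n (f x)).aestronglyMeasurable) hfi.norm
    (fun n => ae_of_all _ fun x => abs_clampAt_le_abs n _)
    (ae_of_all _ fun x => tendsto_clampAt (f x))
  have L3 := tendsto_integral_of_dominated_convergence (μ := μ)
    (F := fun n x => Real.exp (t * clampAt n (f x))) (f := fun x => Real.exp (t * f x)) _
    (fun n => (by fun_prop : Continuous fun x =>
      Real.exp (t * clampAt n (f x))).aestronglyMeasurable) he
    (fun n => ae_of_all _ fun x => by
      rw [Real.norm_of_nonneg (Real.exp_pos _).le]; exact hexp n x)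
    (ae_of_all _ hlim)
  have he' : Integrable (fun y => Real.exp (t * |f y.2.snd|)) h.mixture := by
    rw [← h.map_snd_mixture] at he
    exact he.comp_measurable hsnd
  have L4 := tendsto_integral_of_dominated_convergence (μ := h.mixture)
    (F := fun n y => energy f b t ν y.2 * Real.exp (t * clampAt n (f y.2.snd)))
    (f := fun y => energy f b t ν y.2 * Real.exp (t * f y.2.snd)) _
    (fun n => (by fun_prop : Continuous fun y : ℝ × WithLp 2 (EuclideanSpace ℝ (Fin d) ×
        EuclideanSpace ℝ (Fin d)) =>
      energy f b t ν y.2 * Real.exp (t * clampAt n (f y.2.snd))).aestronglyMeasurable)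
    (he'.const_mul (∑ k, ∫ u, b k * |u| * (Real.exp (t * (b k * |u|)) - 1) ∂(coordLevy ν k)))
    (fun n => ae_of_all _ fun y => by
      rw [norm_mul, Real.norm_of_nonneg (Real.exp_pos _).le]
      have h1 := abs_energy_le hLip hw ht y.2
      exact mul_le_mul h1 (hexp n _) (Real.exp_pos _).le ((abs_nonneg _).trans h1))
    (ae_of_all _ fun y => (hlim _).const_mul _)
  have key := le_of_tendsto_of_tendsto' (L1.sub (L2.mul L3)) L4
    fun n => h.clamp_inequality hLip hw hax ht n
  -- The centering of f removes the product of means from the limiting covariance.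
  rwa [hf0, zero_mul, sub_zero] at key

end Entropy

/-! ### Integrability from independence, and the main theorem. -/

section Assembly

/-- The exponential of the sum is a product of independent integrable factors, taken for a
measurable version of X. -/
lemma integrable_exp_sum_coord {d : ℕ} {Ω : Type*} [MeasurableSpace Ω] {P : Measure Ω}
    [IsProbabilityMeasure P] {X : Ω → EuclideanSpace ℝ (Fin d)} (hX : AEMeasurable X P)
    (hindep : iIndepFun (fun (k : Fin d) (ω : Ω) => X ω k) P) {b : Fin d → ℝ} {s : ℝ}
    (hs : ∀ k, Integrable (fun ω => Real.exp (s * b k * |X ω k|)) P) :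
    Integrable (fun ω => Real.exp (s * ∑ k, b k * |X ω k|)) P := by
  have hmk := hX.ae_eq_mk
  let Y : Fin d → Ω → ℝ := fun k ω => b k * |hX.mk X ω k|
  have hind : iIndepFun Y P := by
    have h1 : iIndepFun (fun (k : Fin d) (ω : Ω) => hX.mk X ω k) P :=
      hindep.congr fun k => hmk.mono fun ω hω => by simp only [hω]
    exact h1.comp (fun k y => b k * |y|) fun k => by fun_prop
  have hYm : ∀ k, Measurable (Y k) := fun k =>
    (by fun_prop : Continuous fun x : EuclideanSpace ℝ (Fin d) => b k * |x k|).measurable.comp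
      hX.measurable_mk
  refine (hind.integrable_exp_mul_sum hYm (t := s) (s := Finset.univ) fun k _ => ?_).congr ?_
  · refine (hs k).congr (hmk.mono fun ω hω => ?_)
    simp only [Y, hω, mul_assoc]
  · refine hmk.mono fun ω hω => ?_
    simp only [Y, hω, Finset.sum_apply]

end Assembly

end IDVec

end

theorem proposition1 {Ω : Type*} [MeasurableSpace Ω] (P : Measure Ω) [IsProbabilityMeasure P]
    (d : ℕ) (X : Ω → EuclideanSpace ℝ (Fin d)) (hX : AEMeasurable X P)
    (γ : EuclideanSpace ℝ (Fin d)) (ν : Measure (EuclideanSpace ℝ (Fin d)))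
    (hID : IDVec.IsIDLaw IDVec.trunc γ ν (P.map X))
    (hindep : iIndepFun (fun (k : Fin d) (ω : Ω) => X ω k) P)
    (hexp : ∃ s : ℝ, 0 < s ∧ Integrable (fun ω => Real.exp (s * ‖X ω‖)) P)
    (f : EuclideanSpace ℝ (Fin d) → ℝ) (hf : ∫ ω, f (X ω) ∂P = 0)
    (b : Fin d → ℝ)
    (hLip : ∀ (k : Fin d) (u : ℝ) (x : EuclideanSpace ℝ (Fin d)),
      |f (x + u • IDVec.unitVec k) - f x| ≤ b k * |u|)
    (ρ : ℝ → Measure (WithLp 2 (EuclideanSpace ℝ (Fin d) × EuclideanSpace ℝ (Fin d))))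
    (hρ : ∀ z ∈ Icc (0 : ℝ) 1,
      IDVec.IsIDLaw IDVec.pairTrunc (WithLp.toLp 2 (γ, γ)) (IDVec.levyInterp ν z) (ρ z))
    (t : ℝ) (ht : 0 ≤ t) (htM : (t : EReal) < IDVec.expRadius P X b) :
    Integrable (fun ω => f (X ω) * Real.exp (t * f (X ω))) P ∧
    (∀ k x y, Integrable (IDVec.integrand f b t k x y) (IDVec.coordLevy ν k)) ∧
    (∀ z ∈ Icc (0 : ℝ) 1, Integrable
      (fun p => ∑ k, ∫ u, IDVec.integrand f b t k p.fst p.snd u ∂(IDVec.coordLevy ν k)) (ρ z)) ∧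
    IntervalIntegrable
      (fun z => ∫ p, ∑ k, ∫ u, IDVec.integrand f b t k p.fst p.snd u ∂(IDVec.coordLevy ν k) ∂(ρ z))
      volume 0 1 ∧
    ∫ ω, f (X ω) * Real.exp (t * f (X ω)) ∂P ≤
      ∫ z in (0 : ℝ)..1,
        ∫ p, ∑ k, ∫ u, IDVec.integrand f b t k p.fst p.snd u ∂(IDVec.coordLevy ν k) ∂(ρ z) := by
  have hI : IDVec.IsInterpolation γ ν (P.map X) ρ := ⟨hID, hρ⟩
  have hax := IDVec.ae_mul_coord_eq_zero hX hID hindep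
  have hfc := IDVec.continuous_of_coordLip hLip
  -- An admissible s > t exists whether M is finite or infinite; all later integrability comes from
  -- the gap between t and s.
  obtain ⟨s', ⟨s, ⟨-, hs⟩, rfl⟩, hts'⟩ := lt_sSup_iff.1 htM
  have hts : t < s := EReal.coe_lt_coe_iff.1 hts'
  have hs0 : 0 ≤ s := ht.trans hts.le
  have hmap : ∀ {k : EuclideanSpace ℝ (Fin d) → ℝ}, Continuous k →
      (Integrable k (P.map X) ↔ Integrable (fun ω => k (X ω)) P) := fun hk =>
    integrable_map_measure hk.aestronglyMeasurable hX
  have hmapi : ∀ {k : EuclideanSpace ℝ (Fin d) → ℝ}, Continuous k →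
      ∫ x, k x ∂(P.map X) = ∫ ω, k (X ω) ∂P := fun hk =>
    integral_map hX hk.aestronglyMeasurable
  have hw : ∀ k, Integrable (fun u : ℝ => b k * |u| * (Real.exp (t * (b k * |u|)) - 1))
      (IDVec.coordLevy ν k) := fun k => by
    refine hI.integrable_coordLevy_mul_exp k (IDVec.coordLip_nonneg hLip k) ht hts ?_
    rw [hmap (by fun_prop)]
    simpa only [mul_assoc] using hs k
  -- Here |f(x)| ≤ |f(0)| + ∑ b_k|x_k|, and independence controls the exponential of the sum.
  have hsf : Integrable (fun x => Real.exp (s * |f x|)) (P.map X) := by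
    rw [hmap (by fun_prop)]
    refine ((IDVec.integrable_exp_sum_coord hX hindep hs).const_mul
      (Real.exp (s * |f 0|))).mono'
      ((by fun_prop : Continuous fun x => Real.exp (s * |f x|)).comp_aestronglyMeasurable
        hX.aestronglyMeasurable) (ae_of_all _ fun ω => ?_)
    rw [Real.norm_of_nonneg (Real.exp_pos _).le, ← Real.exp_add, ← mul_add]
    refine Real.exp_le_exp.2 (mul_le_mul_of_nonneg_left ?_ hs0)
    have h1 := IDVec.abs_sub_le_sum_coord hLip 0 (X ω)
    rw [zero_add] at h1
    linarith [abs_sub_abs_le_abs_sub (f (X ω)) (f 0)]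
  have ham : AEStronglyMeasurable (fun x => |f x|) (P.map X) := hfc.abs.aestronglyMeasurable
  have he := IDVec.integrable_exp_of_le ham (fun x => abs_nonneg _) hts.le hsf
  have hfe := IDVec.integrable_mul_exp_of_lt ham (fun x => abs_nonneg _) hts hsf
  have hfa := IDVec.integrable_mul_exp_of_lt ham (fun x => abs_nonneg _) (ht.trans_lt hts) hsf
  have hfi : Integrable f (P.map X) := by
    refine hfa.mono' hfc.aestronglyMeasurable (ae_of_all _ fun x => ?_)
    simp
  have htf : ∀ x, Real.exp (t * f x) ≤ Real.exp (t * |f x|) := fun x =>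
    Real.exp_le_exp.2 (mul_le_mul_of_nonneg_left (le_abs_self _) ht)
  have he1 : Integrable (fun x => Real.exp (t * f x)) (P.map X) := by
    refine he.mono' (by fun_prop : Continuous fun x => Real.exp (t * f x)).aestronglyMeasurable
      (ae_of_all _ fun x => ?_)
    rw [Real.norm_of_nonneg (Real.exp_pos _).le]
    exact htf x
  have hfe1 : Integrable (fun x => f x * Real.exp (t * f x)) (P.map X) := by
    refine hfe.mono' (by fun_prop : Continuous fun x =>
      f x * Real.exp (t * f x)).aestronglyMeasurable (ae_of_all _ fun x => ?_)
    rw [norm_mul, Real.norm_of_nonneg (Real.exp_pos _).le]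
    exact mul_le_mul_of_nonneg_left (htf x) (abs_nonneg _)
  have hmix := hI.integrable_energy_mixture hLip hw ht he1
  simp_rw [IDVec.sum_integral_integrand_eq]
  refine ⟨(hmap (by fun_prop)).1 hfe1, fun k x y => ?_,
    fun z hz => hI.integrable_energy_pair hLip hw ht he1 hz, ?_, ?_⟩
  · refine ((IDVec.integrable_energyDensity hLip hw ht k x y).mul_const
      (Real.exp (t * f y))).congr (ae_of_all _ fun u => ?_)
    exact (IDVec.integrand_eq k x y u).symm
  · rw [intervalIntegrable_iff_integrableOn_Ioc_of_le zero_le_one]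
    -- Fubini's theorem gives integrability in z for the kernel, which agrees with ρ on (0, 1].
    have h1 : Integrable _ (volume.restrict (Ioc (0 : ℝ) 1)) := Integrable.integral_compProd hmix
    refine h1.congr ((ae_restrict_iff' measurableSet_Ioc).2 (ae_of_all _ fun z hz => ?_))
    change ∫ p, _ ∂(hI.kernel z) = _
    rw [hI.kernel_apply (Ioc_subset_Icc_self hz)]
  · rw [← hI.integral_mixture hmix, ← hmapi (k := fun x => f x * Real.exp (t * f x)) (by fun_prop)]
    exact hI.energy_inequality hLip hw hax ht ((hmapi hfc).trans hf) hfi he hfe
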